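/- Let $d\in\mathbb{N}$ and let $p,q\in\mathbb{R}$ satisfy $2-d\le p<0<q\le 2$ (so that $d\ge 3$). Let $K(x)=|x|^q/q-|x|^p/p$ for $x\in\mathbb{R}^d\setminus\{0\}$ and $K(0)=+\infty$. Let $\varphi:\mathbb{R}^d\to\mathbb{R}$ satisfy - (M1) $\varphi\in C^\infty(\mathbb{R}^d)$, $\varphi\ge 0$, and $\varphi$ is radial; - (M2) $\int_{\mathbb{R}^d}\varphi(x)\,dx=1$; - (M3) there are $C>0$ and $l\ge\max\{2d+1,4\}$ with $\varphi(x)\le C|x|^{-l}$ for all $x\ne 0$. For a function $f$ on $\mathbb{R}^d$ and $\epsilon>0$ write $f_\epsilon(x)=\epsilon^{-d}f(x/\epsilon)$. Let $\mathcal{P}_2(\mathbb{R}^d)$ be the set of Borel probability measures on $\mathbb{R}^d$ with finite second moment, with the 2-Wasserstein distance $$d_W(\mu,\nu)=\Big(\inf_{\gamma}\int_{\mathbb{R}^d\times\mathbb{R}^d}|x-y|^2\,d\gamma(x,y)\Big)^{1/2},$$ where $\gamma$ ranges over the probability measures on $\mathbb{R}^d\times\mathbb{R}^d$ with marginals $\mu$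 and $\nu$. For $\mu\in\mathcal{P}_2(\mathbb{R}^d)$ and $\epsilon>0$ define, with values in $[0,+\infty]$, $$\mathsf{E}(\mu)=\iint K(x-y)\,d\mu(x)\,d\mu(y),\qquad \mathsf{E}_\epsilon(\mu)=\iint K_\epsilon(x-y)\,d\mu(x)\,d\mu(y),\qquad K_\epsilon=\varphi_\epsilon*K*\varphi_\epsilon .$$ Then $\mathsf{E}_\epsilon$ $\Gamma$-converges to $\mathsf{E}$ on $(\mathcal{P}_2(\mathbb{R}^d),d_W)$ as $\epsilon\to0^+$, in the following sense. (i) (Lower semicontinuity) For every family $\{\mu_\epsilon\}_{\epsilon>0}\subset\mathcal{P}_2(\mathbb{R}^d)$ and every $\mu\in\mathcal{P}_2(\mathbb{R}^d)$ with $\lim_{\epsilon\to0^+}d_W(\mu_\epsilon,\mu)=0$, $$\liminf_{\epsilon\to0^+}\mathsf{E}_\epsilon(\mu_\epsilon)\ge\mathsf{E}(\mu).$$ (ii) (Recovery sequence) For every $\mu\in\mathcal{P}_2(\mathbb{R}^d)$ there is a family $\{\nu_\epsilon\}_{\epsilon>0}\subset\mathcal{P}_2(\mathbb{R}^d)$ with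 $$\lim_{\epsilon\to0^+}d_W(\nu_\epsilon,\mu)=0\quad\text{and}\quad\lim_{\epsilon\to0^+}\mathsf{E}_\epsilon(\nu_\epsilon)=\mathsf{E}(\mu);$$ moreover, one may take $\nu_\epsilon=\mu*\psi_{\delta(\epsilon)}$, where $\psi(x)=(4\pi)^{-d/2}e^{-|x|^2/4}$ and $\delta(\epsilon)=\epsilon^{1/(2d)}$. -/

import Mathlib

open Filter Topology MeasureTheory
open scoped ENNReal ContDiff

noncomputable section

/-- The space of Borel probability measures on `ℝᵈ` with finite second moment. -/
def P2 (d : ℕ) : Type :=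
  {μ : ProbabilityMeasure (EuclideanSpace ℝ (Fin d)) //
    ∫⁻ x, ‖x‖ₑ ^ 2 ∂(μ : Measure (EuclideanSpace ℝ (Fin d))) < ⊤}

/-- The measure underlying an element of `P2 d`. -/
def P2.meas {d : ℕ} (μ : P2 d) : Measure (EuclideanSpace ℝ (Fin d)) :=
  (μ.1 : Measure (EuclideanSpace ℝ (Fin d)))

/-- The transport plans between `μ` and `ν`: probability measures on `ℝᵈ × ℝᵈ` with marginals
`μ` and `ν`. -/
def transportPlans {d : ℕ} (μ ν : Measure (EuclideanSpace ℝ (Fin d))) :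
    Set (ProbabilityMeasure (EuclideanSpace ℝ (Fin d) × EuclideanSpace ℝ (Fin d))) :=
  {γ | (γ : Measure (EuclideanSpace ℝ (Fin d) × EuclideanSpace ℝ (Fin d))).map Prod.fst = μ ∧
       (γ : Measure (EuclideanSpace ℝ (Fin d) × EuclideanSpace ℝ (Fin d))).map Prod.snd = ν}

/-- The 2-Wasserstein distance on `P2 d`, as an extended nonnegative real. -/
def dW {d : ℕ} (μ ν : P2 d) : ℝ≥0∞ :=
  (⨅ γ ∈ transportPlans μ.meas ν.meas,
    ∫⁻ z, ‖z.1 - z.2‖ₑ ^ 2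
      ∂(γ : Measure (EuclideanSpace ℝ (Fin d) × EuclideanSpace ℝ (Fin d)))) ^ (1 / 2 : ℝ)

/-- The power-law kernel `K(x) = |x|^q / q - |x|^p / p`, with its value `+∞` at the origin
(it is used for `p < 0 < q` only, where it is nonnegative). -/
def powerKernel (d : ℕ) (p q : ℝ) (x : EuclideanSpace ℝ (Fin d)) : ℝ≥0∞ :=
  open Classical in if x = 0 then ⊤ else ENNReal.ofReal (‖x‖ ^ q / q - ‖x‖ ^ p / p)

/-- The interaction energy `∬ K(x - y) dμ(x) dμ(y)` of a nonnegative kernel `K`. -/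
def interactionEnergy {d : ℕ} (K : EuclideanSpace ℝ (Fin d) → ℝ≥0∞) (μ : P2 d) : ℝ≥0∞ :=
  ∫⁻ y, ∫⁻ x, K (x - y) ∂μ.meas ∂μ.meas

/-- The rescaling `φ_ε(x) = ε^{-d} φ(x / ε)`. -/
def rescale {d : ℕ} (φ : EuclideanSpace ℝ (Fin d) → ℝ) (ε : ℝ) :
    EuclideanSpace ℝ (Fin d) → ℝ :=
  fun x => (ε ^ d)⁻¹ * φ (ε⁻¹ • x)

/-- The regularized kernel `K_ε = φ_ε * K * φ_ε` of a nonnegative kernel `K`. -/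
def regKernel {d : ℕ} (φ : EuclideanSpace ℝ (Fin d) → ℝ)
    (K : EuclideanSpace ℝ (Fin d) → ℝ≥0∞) (ε : ℝ) : EuclideanSpace ℝ (Fin d) → ℝ≥0∞ :=
  (fun x => ENNReal.ofReal (rescale φ ε x)) ⋆ₗ (K ⋆ₗ (fun x => ENNReal.ofReal (rescale φ ε x)))

/-- Admissible mollifiers: smooth, radial, nonnegative, of integral one, and bounded by
`C |x|^{-l}` for some `C > 0` and `l ≥ max (2d + 1) 4`. -/
structure IsAdmissibleMollifier {d : ℕ} (φ : EuclideanSpace ℝ (Fin d) → ℝ) : Prop where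
  smooth : ContDiff ℝ ∞ φ
  radial : ∀ x y, ‖x‖ = ‖y‖ → φ x = φ y
  nonneg : ∀ x, 0 ≤ φ x
  integral_eq_one : ∫ x, φ x = 1
  decay : ∃ C > (0 : ℝ), ∃ l : ℝ, max (2 * (d : ℝ) + 1) 4 ≤ l ∧ ∀ x, x ≠ 0 → φ x ≤ C * ‖x‖ ^ (-l)

/-- The heat kernel at time one, `ψ(x) = (4π)^{-d/2} exp (-|x|² / 4)`. -/
def heatKernel (d : ℕ) (x : EuclideanSpace ℝ (Fin d)) : ℝ :=
  (4 * Real.pi) ^ (-(d : ℝ) / 2) * Real.exp (-‖x‖ ^ 2 / 4)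

/-- The convolution `μ * φ` of a measure and a nonnegative function, namely the convolution of `μ`
with the measure `φ(x) dx`; for measurable `φ` it has the Lebesgue density
`x ↦ ∫ φ(x - y) dμ(y)`. -/
def measConv {d : ℕ} (μ : Measure (EuclideanSpace ℝ (Fin d)))
    (φ : EuclideanSpace ℝ (Fin d) → ℝ) : Measure (EuclideanSpace ℝ (Fin d)) :=
  μ.conv (volume.withDensity fun x => ENNReal.ofReal (φ x))

end

/-! ### Lower semicontinuity of integrals under weak convergence -/

/-! Both halves rest on a probabilistic reading of the energy: `E_ε(μ)` is the expectation of `K(X -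
Y - εa - εc)`, with `X, Y` of law `μ` and `a, c` of law `φ dx`, all independent
(`interactionEnergy_regKernel`).

Lower bound. `K` is continuous into `[0,∞]`, the origin included. Wasserstein convergence implies
weak convergence, products of weakly convergent laws converge weakly, and the law of `εa` tends to
the Dirac mass at `0`. The integral of a continuous nonnegative function is weakly lower
semicontinuous (`interactionEnergy_le_liminf`).

Recovery. For `ν_ε = μ * ψ_δ` the energy is that of `μ` for a smeared kernel, the average of `K`
over `z + δ(u - u') - ε(a + c)` (`interactionEnergy_regKernel_measConv`). If `E(μ) = ∞`, the lower
bound already gives the limit. Otherwise dominated convergence applies to each power separately. The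
smeared `|z|^q` is at most a constant plus `2|z|²`, as `q ≤ 2` and second moments are finite. The
smeared `|z|^p` is at most `C|z|^p` with `C` independent of both scales, because `p > -d` and the
mollifiers are bounded by a multiple of `|x|^{-d}`
(`IsAdmissibleMollifier.exists_lintegral_enorm_rpow_le`). Applied to an exponent between `-d` and
`p`, the same bound supplies the uniform integrability behind pointwise convergence off the origin.
Of `δ(ε)`, only positivity and the limit `0` matter. -/

theorem lintegral_le_liminf_of_tendsto_probabilityMeasure {ι Ω : Type*} {L : Filter ι}
    [MeasurableSpace Ω] [TopologicalSpace Ω] [OpensMeasurableSpace Ω]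
    {μs : ι → ProbabilityMeasure Ω} {μ : ProbabilityMeasure Ω} (h : Tendsto μs L (𝓝 μ))
    {K : Ω → ℝ≥0∞} (hK : Continuous K) :
    ∫⁻ x, K x ∂(μ : Measure Ω) ≤ liminf (fun i => ∫⁻ x, K x ∂(μs i : Measure Ω)) L := by
  rcases L.eq_or_neBot with rfl | hL
  · simp
  -- The truncations `min K n` are bounded and continuous, so their integrals converge; monotone
  -- convergence in `n` then recovers `K`.
  have hsup : ∀ x, K x = ⨆ n : ℕ, min (K x) n := by
    intro x
    rw [← inf_iSup_eq, ENNReal.iSup_natCast, inf_top_eq]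
  have hmono : Monotone fun (n : ℕ) (x : Ω) => min (K x) n := by
    intro m n hmn x
    exact min_le_min le_rfl (by exact_mod_cast hmn)
  have hcont : ∀ n : ℕ, Continuous fun x => min (K x) n := fun n => hK.min continuous_const
  rw [lintegral_congr hsup, lintegral_iSup (fun n => (hcont n).measurable) hmono]
  refine iSup_le fun n => ?_
  have hfin : ∀ x, min (K x) n ≠ ⊤ := fun x => ne_top_of_le_ne_top (by simp) (min_le_right _ _)
  let f : BoundedContinuousFunction Ω NNReal :=
    BoundedContinuousFunction.mkOfBound
      ⟨fun x => (min (K x) n).toNNReal, ENNReal.continuousOn_toNNReal.comp_continuous (hcont n) hfin⟩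
      n (by
        intro x y
        have hb : ∀ x, ((min (K x) n).toNNReal : ℝ) ≤ n := by
          intro x
          have : (min (K x) n).toNNReal ≤ n := by
            rw [← ENNReal.coe_le_coe, ENNReal.coe_toNNReal (hfin x)]
            simp
          exact_mod_cast this
        rw [NNReal.dist_eq, abs_le]
        have h1 := hb x
        have h2 := hb y
        have h3 : (0 : ℝ) ≤ (min (K x) n).toNNReal := NNReal.coe_nonneg _
        have h4 : (0 : ℝ) ≤ (min (K y) n).toNNReal := NNReal.coe_nonneg _
        constructor <;> simp only [ContinuousMap.coe_mk] <;> linarith)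
  have hf : ∀ x, (f x : ℝ≥0∞) = min (K x) n := fun x => ENNReal.coe_toNNReal (hfin x)
  have hlim := (ProbabilityMeasure.tendsto_iff_forall_lintegral_tendsto.1 h) f
  simp_rw [hf] at hlim
  rw [← hlim.liminf_eq]
  exact liminf_le_liminf (Eventually.of_forall fun i =>
    lintegral_mono fun x => min_le_left _ _)

/-! ### Wasserstein convergence implies weak convergence -/

/-- For every plan, the difference of integrals is at most `L ∫ |x - y| dγ`, hence at most `L (∫ |x
- y|² dγ)^{1/2}`. The bound is kept squared until the infimum over plans has been taken. The
oscillation bound serves to make `f` integrable. -/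
theorem edist_integral_le_mul_dW {d : ℕ} {f : EuclideanSpace ℝ (Fin d) → ℝ} {L : NNReal}
    (hf : LipschitzWith L f) {C : ℝ} (hC : ∀ x y, dist (f x) (f y) ≤ C) (μ ν : P2 d) :
    edist (∫ x, f x ∂μ.meas) (∫ x, f x ∂ν.meas) ≤ L * dW μ ν := by
  have hint : ∀ ρ : Measure (EuclideanSpace ℝ (Fin d) × EuclideanSpace ℝ (Fin d)),
      IsProbabilityMeasure ρ → Integrable (fun z => f z.1) ρ ∧ Integrable (fun z => f z.2) ρ := by
    intro ρ _
    have hb : ∀ x, ‖f x‖ ≤ C + ‖f 0‖ := by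
      intro x
      have := hC x 0
      rw [dist_eq_norm] at this
      have h2 := norm_sub_norm_le (f x) (f 0)
      linarith
    exact ⟨Integrable.of_bound (hf.continuous.comp continuous_fst).aestronglyMeasurable _
        (Eventually.of_forall fun z => hb z.1),
      Integrable.of_bound (hf.continuous.comp continuous_snd).aestronglyMeasurable _
        (Eventually.of_forall fun z => hb z.2)⟩
  have key : ∀ γ ∈ transportPlans μ.meas ν.meas,
      edist (∫ x, f x ∂μ.meas) (∫ x, f x ∂ν.meas) ^ 2 ≤
        L ^ 2 * ∫⁻ z, ‖z.1 - z.2‖ₑ ^ 2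
          ∂(γ : Measure (EuclideanSpace ℝ (Fin d) × EuclideanSpace ℝ (Fin d))) := by
    rintro γ ⟨h1, h2⟩
    have hi := hint γ inferInstance
    rw [← h1, ← h2, integral_map measurable_fst.aemeasurable hf.continuous.aestronglyMeasurable,
      integral_map measurable_snd.aemeasurable hf.continuous.aestronglyMeasurable,
      edist_eq_enorm_sub, ← integral_sub hi.1 hi.2]
    have hLip : ∀ z : EuclideanSpace ℝ (Fin d) × EuclideanSpace ℝ (Fin d),
        ‖f z.1 - f z.2‖ₑ ≤ L * ‖z.1 - z.2‖ₑ := by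
      intro z
      rw [← edist_eq_enorm_sub, ← edist_eq_enorm_sub]
      exact hf z.1 z.2
    have hLp := eLpNorm_le_eLpNorm_of_exponent_le
      (μ := (γ : Measure (EuclideanSpace ℝ (Fin d) × EuclideanSpace ℝ (Fin d))))
      (f := fun z => z.1 - z.2) (p := 1) (q := 2) (by norm_num)
      (by fun_prop)
    rw [eLpNorm_one_eq_lintegral_enorm,
      eLpNorm_eq_lintegral_rpow_enorm_toReal (by norm_num) (by norm_num)] at hLp
    have h3 : ‖∫ z, (f z.1 - f z.2)
        ∂(γ : Measure (EuclideanSpace ℝ (Fin d) × EuclideanSpace ℝ (Fin d)))‖ₑ ≤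
        L * ∫⁻ z, ‖z.1 - z.2‖ₑ
          ∂(γ : Measure (EuclideanSpace ℝ (Fin d) × EuclideanSpace ℝ (Fin d))) := by
      refine (enorm_integral_le_lintegral_enorm _).trans ?_
      rw [← lintegral_const_mul _ (by fun_prop)]
      exact lintegral_mono hLip
    refine (pow_le_pow_left' (h3.trans (mul_le_mul_right hLp _)) 2).trans_eq ?_
    rw [mul_pow, ← ENNReal.rpow_natCast (_ ^ _), ← ENNReal.rpow_mul]
    simp
  have hle : edist (∫ x, f x ∂μ.meas) (∫ x, f x ∂ν.meas) ^ 2 ≤ L ^ 2 *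
      ⨅ γ ∈ transportPlans μ.meas ν.meas, ∫⁻ z, ‖z.1 - z.2‖ₑ ^ 2
          ∂(γ : Measure (EuclideanSpace ℝ (Fin d) × EuclideanSpace ℝ (Fin d))) := by
    -- Multiplication by `L²` passes through the infimum only for `L ≠ 0`: an infimum over an empty
    -- family is `⊤`, while `0 * ⊤ = 0`.
    rcases eq_or_ne L 0 with rfl | hL
    · have : IsProbabilityMeasure μ.meas := μ.1.2
      have : IsProbabilityMeasure ν.meas := ν.1.2
      have hconst : ∀ x, f x = f 0 := by
        intro x
        have := hf x 0
        simpa using this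
      simp only [hconst]
      simp
    · rw [ENNReal.mul_iInf_of_ne (by simpa using hL) (by simp)]
      refine le_iInf fun γ => ?_
      rw [ENNReal.mul_iInf_of_ne (by simpa using hL) (by simp)]
      exact le_iInf fun hγ => key γ hγ
  have := ENNReal.rpow_le_rpow hle (show (0 : ℝ) ≤ 1 / 2 by norm_num)
  rw [ENNReal.mul_rpow_of_nonneg _ _ (by norm_num), ← ENNReal.rpow_natCast,
    ← ENNReal.rpow_natCast, ← ENNReal.rpow_mul, ← ENNReal.rpow_mul] at this
  simpa [dW] using this

theorem tendsto_probabilityMeasure_of_dW {ι : Type*} {l : Filter ι} [l.IsCountablyGenerated]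
    {d : ℕ} {μs : ι → P2 d} {μ : P2 d} (h : Tendsto (fun i => dW (μs i) μ) l (𝓝 0)) :
    Tendsto (fun i => (μs i).1) l (𝓝 μ.1) := by
  rw [tendsto_iff_forall_lipschitz_integral_tendsto]
  rintro f ⟨C, hC⟩ ⟨L, hL⟩
  rw [tendsto_iff_edist_tendsto_0]
  have h0 : Tendsto (fun i => (L : ℝ≥0∞) * dW (μs i) μ) l (𝓝 0) := by
    simpa using ENNReal.Tendsto.const_mul h (Or.inr (ENNReal.coe_ne_top (r := L)))
  exact tendsto_of_tendsto_of_tendsto_of_le_of_le tendsto_const_nhds h0 (fun i => zero_le)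
    (fun i => edist_integral_le_mul_dW hL hC (μs i) μ)

/-! ### Mollifiers as probability measures -/

/-- The measure on `ℝᵈ` with Lebesgue density `φ`. -/
noncomputable def densityMeasure {d : ℕ} (φ : EuclideanSpace ℝ (Fin d) → ℝ) :
    Measure (EuclideanSpace ℝ (Fin d)) :=
  volume.withDensity fun x => ENNReal.ofReal (φ x)

instance {d : ℕ} (φ : EuclideanSpace ℝ (Fin d) → ℝ) : SFinite (densityMeasure φ) := by
  unfold densityMeasure; infer_instance

theorem lintegral_densityMeasure {d : ℕ} {φ : EuclideanSpace ℝ (Fin d) → ℝ} (hφ : Measurable φ)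
    {f : EuclideanSpace ℝ (Fin d) → ℝ≥0∞} (hf : Measurable f) :
    ∫⁻ x, f x ∂densityMeasure φ = ∫⁻ x, ENNReal.ofReal (φ x) * f x := by
  rw [densityMeasure, lintegral_withDensity_eq_lintegral_mul _ hφ.ennreal_ofReal hf]
  rfl

/-- A linear change of variables. It moves the scale from the density to the integrand, so that all
scales share one probability space. -/
theorem densityMeasure_rescale {d : ℕ} {φ : EuclideanSpace ℝ (Fin d) → ℝ} (hφ : Measurable φ)
    {ε : ℝ} (hε : 0 < ε) :
    densityMeasure (rescale φ ε) = (densityMeasure φ).map (fun x => ε • x) := by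
  have hr : Measurable (rescale φ ε) := by unfold rescale; fun_prop
  refine Measure.ext_of_lintegral _ fun f hf => ?_
  rw [lintegral_map hf (by fun_prop), lintegral_densityMeasure hr hf,
    lintegral_densityMeasure hφ (by fun_prop)]
  have h := lintegral_map (μ := (volume : Measure (EuclideanSpace ℝ (Fin d))))
    (f := fun x => ENNReal.ofReal (φ (ε⁻¹ • x)) * f x) (g := fun x => ε • x)
    (by fun_prop) (by fun_prop)
  rw [Measure.map_addHaar_smul _ hε.ne', lintegral_smul_measure] at h
  simp only [smul_smul, inv_mul_cancel₀ hε.ne', one_smul, finrank_euclideanSpace,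
    Fintype.card_fin, smul_eq_mul] at h
  rw [← h, ← lintegral_const_mul _ (by fun_prop)]
  refine lintegral_congr fun x => ?_
  rw [rescale, ENNReal.ofReal_mul (by positivity), abs_of_pos (by positivity), mul_assoc]

theorem lintegral_densityMeasure_rescale {d : ℕ} {φ : EuclideanSpace ℝ (Fin d) → ℝ}
    (hφ : Measurable φ) {ε : ℝ} (hε : 0 < ε) {f : EuclideanSpace ℝ (Fin d) → ℝ≥0∞}
    (hf : Measurable f) :
    ∫⁻ x, f x ∂densityMeasure (rescale φ ε) = ∫⁻ x, f (ε • x) ∂densityMeasure φ := by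
  rw [densityMeasure_rescale hφ hε, lintegral_map hf (by fun_prop)]

theorem regKernel_eq {d : ℕ} {φ : EuclideanSpace ℝ (Fin d) → ℝ} (hφ : Measurable φ)
    {K : EuclideanSpace ℝ (Fin d) → ℝ≥0∞} (hK : Measurable K) {ε : ℝ} (hε : 0 < ε)
    (z : EuclideanSpace ℝ (Fin d)) :
    regKernel φ K ε z =
      ∫⁻ a, ∫⁻ c, K (z - ε • a - ε • c) ∂densityMeasure φ ∂densityMeasure φ := by
  have hr : Measurable (rescale φ ε) := by unfold rescale; fun_prop
  have h1 : ∀ (g : EuclideanSpace ℝ (Fin d) → ℝ≥0∞) (w : EuclideanSpace ℝ (Fin d)),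
      Measurable g → ((fun x => ENNReal.ofReal (rescale φ ε x)) ⋆ₗ g) w =
        ∫⁻ a, g (w - ε • a) ∂densityMeasure φ := by
    intro g w hg
    rw [← lintegral_densityMeasure_rescale hφ hε (f := fun a => g (w - a)) (by fun_prop),
      lintegral_densityMeasure hr (by fun_prop), lconvolution_def]
    refine lintegral_congr fun a => ?_
    rw [neg_add_eq_sub]
  rw [regKernel, lconvolution_comm (f := K), h1]
  · exact lintegral_congr fun a => h1 K _ hK
  · exact measurable_lconvolution _ (by fun_prop) hK

theorem IsAdmissibleMollifier.isProbabilityMeasure {d : ℕ} {φ : EuclideanSpace ℝ (Fin d) → ℝ}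
    (hφ : IsAdmissibleMollifier φ) : IsProbabilityMeasure (densityMeasure φ) := by
  refine ⟨?_⟩
  -- The integral of a non-integrable function is `0` by convention, so integral one forces
  -- integrability.
  have hi : Integrable φ := by
    by_contra h
    have := hφ.integral_eq_one
    rw [integral_undef h] at this
    exact zero_ne_one this
  rw [densityMeasure, withDensity_apply _ MeasurableSet.univ, Measure.restrict_univ,
    ← ofReal_integral_eq_lintegral_ofReal hi (Eventually.of_forall hφ.nonneg),
    hφ.integral_eq_one, ENNReal.ofReal_one]

theorem IsAdmissibleMollifier.measurable {d : ℕ} {φ : EuclideanSpace ℝ (Fin d) → ℝ}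
    (hφ : IsAdmissibleMollifier φ) : Measurable φ :=
  hφ.smooth.continuous.measurable

/-- An admissible mollifier is dominated by the Japanese bracket to any power at most `2d + 1`. -/
theorem IsAdmissibleMollifier.exists_le_one_add_norm {d : ℕ} {φ : EuclideanSpace ℝ (Fin d) → ℝ}
    (hφ : IsAdmissibleMollifier φ) :
    ∃ A > (0 : ℝ), ∀ x, φ x ≤ A * (1 + ‖x‖) ^ (-(2 * (d : ℝ) + 1)) := by
  obtain ⟨C, hC, l, hl, hdec⟩ := hφ.decay
  have hl' : 2 * (d : ℝ) + 1 ≤ l := (le_max_left _ _).trans hl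
  obtain ⟨M, hM⟩ := (isCompact_closedBall (0 : EuclideanSpace ℝ (Fin d)) 1).bddAbove_image
    hφ.smooth.continuous.continuousOn
  have hM' : ∀ x, ‖x‖ ≤ 1 → φ x ≤ M := fun x hx => hM ⟨x, by simpa using hx, rfl⟩
  have hM0 : 0 ≤ M := (hφ.nonneg 0).trans (hM' 0 (by simp))
  have h2 : (0 : ℝ) < 2 ^ (2 * (d : ℝ) + 1) := by positivity
  -- The power of `2` turns `1 + |x|` into `(1 + |x|)/2`, which is at most `1` on the unit ball,
  -- where `φ ≤ M`, and at most `|x|` outside it, where `φ ≤ C|x|^{-l}`.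
  refine ⟨(M + C) * 2 ^ (2 * (d : ℝ) + 1), by positivity, fun x => ?_⟩
  have hx1 : 0 < 1 + ‖x‖ := by positivity
  have hbr : (2 : ℝ) ^ (2 * (d : ℝ) + 1) * (1 + ‖x‖) ^ (-(2 * (d : ℝ) + 1)) =
      ((1 + ‖x‖) / 2) ^ (-(2 * (d : ℝ) + 1)) := by
    rw [Real.div_rpow hx1.le (by norm_num), Real.rpow_neg (by norm_num : (0:ℝ) ≤ 2)]
    field_simp
  rw [mul_assoc, hbr]
  rcases le_total ‖x‖ 1 with hx | hx
  · have : 1 ≤ ((1 + ‖x‖) / 2) ^ (-(2 * (d : ℝ) + 1)) :=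
      Real.one_le_rpow_of_pos_of_le_one_of_nonpos (by positivity) (by linarith)
        (by have : (0 : ℝ) ≤ d := by positivity
            linarith)
    have := hM' x hx
    nlinarith
  · have hx0 : x ≠ 0 := by
      rintro rfl
      norm_num at hx
    have h3 : ‖x‖ ^ (-l) ≤ ((1 + ‖x‖) / 2) ^ (-(2 * (d : ℝ) + 1)) :=
      (Real.rpow_le_rpow_of_exponent_le hx (by linarith)).trans
        (Real.rpow_le_rpow_of_nonpos (by positivity) (by linarith)
          (by have : (0 : ℝ) ≤ d := by positivity
              linarith))
    have h4 : 0 ≤ ((1 + ‖x‖) / 2) ^ (-(2 * (d : ℝ) + 1)) := by positivity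
    have h5 := mul_le_mul_of_nonneg_left h3 hC.le
    have := hdec x hx0
    nlinarith

/-- The bound `A|x|^{-d}` is invariant under `φ ↦ φ_ε`; this makes the Riesz estimate uniform in the
scale. -/
theorem IsAdmissibleMollifier.exists_le_norm_rpow {d : ℕ} {φ : EuclideanSpace ℝ (Fin d) → ℝ}
    (hφ : IsAdmissibleMollifier φ) :
    ∃ A > (0 : ℝ), ∀ x, x ≠ 0 → φ x ≤ A * ‖x‖ ^ (-(d : ℝ)) := by
  obtain ⟨A, hA, h⟩ := hφ.exists_le_one_add_norm
  refine ⟨A, hA, fun x hx => (h x).trans ?_⟩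
  have hx' : 0 < ‖x‖ := norm_pos_iff.2 hx
  have hd : (0 : ℝ) ≤ d := by positivity
  refine mul_le_mul_of_nonneg_left ?_ hA.le
  exact (Real.rpow_le_rpow_of_exponent_le (by linarith) (by linarith)).trans
    (Real.rpow_le_rpow_of_nonpos hx' (by linarith) (by linarith))

/-- The integrand is at most a multiple of `(1 + |x|)^{-(2d-1)}`, which is integrable because `2d -
1 > d`. -/
theorem IsAdmissibleMollifier.lintegral_enorm_sq_lt_top {d : ℕ} (hd : 2 ≤ d)
    {φ : EuclideanSpace ℝ (Fin d) → ℝ} (hφ : IsAdmissibleMollifier φ) :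
    ∫⁻ x, ‖x‖ₑ ^ 2 ∂densityMeasure φ < ⊤ := by
  obtain ⟨A, hA, h⟩ := hφ.exists_le_one_add_norm
  have hd' : (2 : ℝ) ≤ d := by exact_mod_cast hd
  have hi : Integrable (fun x : EuclideanSpace ℝ (Fin d) =>
      A * (1 + ‖x‖) ^ (-(2 * (d : ℝ) - 1))) := by
    refine (integrable_one_add_norm ?_).const_mul A
    rw [finrank_euclideanSpace, Fintype.card_fin]
    linarith
  rw [lintegral_densityMeasure hφ.measurable (by fun_prop)]
  refine lt_of_le_of_lt (lintegral_mono fun x => ?_) hi.2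
  rw [← ofReal_norm, ← ENNReal.ofReal_pow (norm_nonneg _),
    ← ENNReal.ofReal_mul (hφ.nonneg x), ← ofReal_norm]
  refine ENNReal.ofReal_le_ofReal ?_
  have hx1 : 0 < 1 + ‖x‖ := by positivity
  rw [Real.norm_of_nonneg (by positivity)]
  have he : (1 + ‖x‖) ^ (-(2 * (d : ℝ) - 1)) =
      (1 + ‖x‖) ^ (-(2 * (d : ℝ) + 1)) * (1 + ‖x‖) ^ 2 := by
    rw [← Real.rpow_natCast, ← Real.rpow_add hx1]
    congr 1
    push_cast
    ring
  beta_reduce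
  rw [he, ← mul_assoc]
  exact mul_le_mul (h x) (pow_le_pow_left₀ (norm_nonneg _) (by linarith) 2) (by positivity)
    (by positivity)

theorem isAdmissibleMollifier_heatKernel (d : ℕ) : IsAdmissibleMollifier (heatKernel d) where
  smooth := by
    unfold heatKernel
    exact contDiff_const.mul (((contDiff_norm_sq ℝ).neg.div_const 4).exp)
  radial x y h := by simp [heatKernel, h]
  nonneg x := by unfold heatKernel; positivity
  integral_eq_one := by
    have h := GaussianFourier.integral_rexp_neg_mul_sq_norm (V := EuclideanSpace ℝ (Fin d))
      (b := 1 / 4) (by norm_num)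
    simp only [heatKernel]
    rw [integral_const_mul]
    have he : ∀ v : EuclideanSpace ℝ (Fin d), -‖v‖ ^ 2 / 4 = -(1 / 4) * ‖v‖ ^ 2 := by
      intro v; ring
    simp_rw [he]
    rw [h, finrank_euclideanSpace, Fintype.card_fin, show Real.pi / (1 / 4) = 4 * Real.pi by ring,
      ← Real.rpow_add (by positivity)]
    simp [neg_div]
  decay := by
    obtain ⟨n, hn⟩ := exists_nat_ge (max (2 * (d : ℝ) + 1) 4)
    -- From `exp s ≥ s^n / n!` at `s = |x|²/4` follows `exp(-s) ≤ n! 4^n |x|^{-2n}`, so the decay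
    -- exponent is `2n`.
    refine ⟨(4 * Real.pi) ^ (-(d : ℝ) / 2) * (n.factorial * 4 ^ n), by positivity,
      ((2 * n : ℕ) : ℝ), ?_, fun x hx => ?_⟩
    · push_cast
      have : (0 : ℝ) ≤ n := by positivity
      linarith
    · have hx' : 0 < ‖x‖ := norm_pos_iff.2 hx
      rw [heatKernel, mul_assoc]
      refine mul_le_mul_of_nonneg_left ?_ (by positivity)
      have h1 := Real.pow_div_factorial_le_exp (‖x‖ ^ 2 / 4) (by positivity) n
      rw [neg_div, Real.exp_neg, Real.rpow_neg hx'.le, Real.rpow_natCast]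
      have h2 : (n.factorial * 4 ^ n : ℝ) * (‖x‖ ^ (2 * n))⁻¹ =
          ((‖x‖ ^ 2 / 4) ^ n / n.factorial)⁻¹ := by
        rw [div_pow, pow_mul]
        field_simp
      rw [h2]
      exact inv_anti₀ (by positivity) h1

/-! ### The Riesz potential part of the kernel -/

theorem enorm_rpow_of_ne_zero {E : Type*} [NormedAddCommGroup E] {x : E} (hx : x ≠ 0) (s : ℝ) :
    ‖x‖ₑ ^ s = ENNReal.ofReal (‖x‖ ^ s) := by
  rw [← ofReal_norm, ENNReal.ofReal_rpow_of_pos (norm_pos_iff.2 hx)]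

theorem ennreal_rpow_le_rpow_of_nonpos {a b : ℝ≥0∞} {s : ℝ} (hs : s ≤ 0) (hab : a ≤ b) :
    b ^ s ≤ a ^ s := by
  rw [← neg_neg s, ENNReal.rpow_neg b (-s), ENNReal.rpow_neg a (-s)]
  exact ENNReal.inv_le_inv.2 (ENNReal.rpow_le_rpow hab (neg_nonneg.2 hs))

/-- In polar coordinates this is the convergence of `∫₀¹ r^{d-1+p} dr`. -/
theorem lintegral_unitBall_enorm_rpow_lt_top {d : ℕ} (hd : 0 < d) {p : ℝ} (hp : -(d : ℝ) < p) :
    ∫⁻ y in Metric.ball (0 : EuclideanSpace ℝ (Fin d)) 1, ‖y‖ₑ ^ p < ⊤ := by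
  have : Nonempty (Fin d) := ⟨⟨0, hd⟩⟩
  have hi : IntegrableOn (fun x : EuclideanSpace ℝ (Fin d) => ‖x‖ ^ p) (Metric.ball 0 1) := by
    rw [integrableOn_fun_norm_addHaar volume (f := fun y => y ^ p)]
    have h : IntegrableOn (fun y : ℝ => y ^ ((d : ℝ) - 1 + p)) (Set.Ioo 0 1) :=
      (intervalIntegral.integrableOn_Ioo_rpow_iff one_pos).2 (by linarith)
    refine h.congr_fun (fun y hy => ?_) measurableSet_Ioo
    simp only [finrank_euclideanSpace, Fintype.card_fin, smul_eq_mul]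
    rw [Real.rpow_add hy.1, ← Real.rpow_natCast, Nat.cast_sub hd, Nat.cast_one]
  refine lt_of_le_of_lt (lintegral_mono_ae ?_) hi.2
  have h0 : ∀ᵐ x : EuclideanSpace ℝ (Fin d), x ≠ 0 := by
    simp [ae_iff]
  filter_upwards [ae_restrict_of_ae h0] with x hx
  rw [enorm_rpow_of_ne_zero hx, ← ofReal_norm, Real.norm_of_nonneg (by positivity)]

theorem lintegral_ball_enorm_rpow {d : ℕ} {p : ℝ} {r : ℝ} (hr : 0 < r) :
    ∫⁻ y in Metric.ball (0 : EuclideanSpace ℝ (Fin d)) r, ‖y‖ₑ ^ p =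
      ENNReal.ofReal (r ^ ((d : ℝ) + p)) *
        ∫⁻ y in Metric.ball (0 : EuclideanSpace ℝ (Fin d)) 1, ‖y‖ₑ ^ p := by
  rw [← lintegral_indicator measurableSet_ball, ← lintegral_indicator measurableSet_ball]
  have hm : ∀ r : ℝ, Measurable ((Metric.ball (0 : EuclideanSpace ℝ (Fin d)) r).indicator
      fun y => ‖y‖ₑ ^ p) := fun r => Measurable.indicator (by fun_prop) measurableSet_ball
  have h := lintegral_map (μ := (volume : Measure (EuclideanSpace ℝ (Fin d)))) (hm r)
    (g := fun x => r • x) (by fun_prop)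
  rw [Measure.map_addHaar_smul _ hr.ne', lintegral_smul_measure, finrank_euclideanSpace,
    Fintype.card_fin, abs_of_pos (by positivity), smul_eq_mul] at h
  have he : ∀ x : EuclideanSpace ℝ (Fin d),
      (Metric.ball (0 : EuclideanSpace ℝ (Fin d)) r).indicator (fun y => ‖y‖ₑ ^ p) (r • x) =
      ENNReal.ofReal (r ^ p) *
        (Metric.ball (0 : EuclideanSpace ℝ (Fin d)) 1).indicator (fun y => ‖y‖ₑ ^ p) x := by
    intro x
    have hiff : r • x ∈ Metric.ball (0 : EuclideanSpace ℝ (Fin d)) r ↔ x ∈ Metric.ball 0 1 := by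
      rw [mem_ball_zero_iff, mem_ball_zero_iff, norm_smul, Real.norm_of_nonneg hr.le]
      exact mul_lt_iff_lt_one_right hr
    by_cases hx : x ∈ Metric.ball (0 : EuclideanSpace ℝ (Fin d)) 1
    · rw [Set.indicator_of_mem (hiff.2 hx), Set.indicator_of_mem hx, enorm_smul,
        ENNReal.mul_rpow_of_ne_top (by simp) (by simp), enorm_rpow_of_ne_zero hr.ne',
        Real.norm_of_nonneg hr.le]
    · rw [Set.indicator_of_notMem (fun h => hx (hiff.1 h)), Set.indicator_of_notMem hx, mul_zero]
  simp_rw [he] at h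
  rw [lintegral_const_mul _ (hm 1)] at h
  rw [Real.rpow_add hr, Real.rpow_natCast, ENNReal.ofReal_mul (by positivity), mul_assoc, ← h,
    ← mul_assoc, ← ENNReal.ofReal_mul (by positivity), mul_inv_cancel₀ (by positivity)]
  simp

/-- Averaging the Riesz kernel `|x|^p`, `-d < p < 0`, against a rescaled admissible mollifier
increases it by at most a constant factor, uniformly in the scale. -/
theorem IsAdmissibleMollifier.exists_lintegral_enorm_rpow_le {d : ℕ} (hd : 0 < d)
    {φ : EuclideanSpace ℝ (Fin d) → ℝ} (hφ : IsAdmissibleMollifier φ) {p : ℝ}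
    (hp : -(d : ℝ) < p) (hp0 : p < 0) :
    ∃ C : ℝ≥0∞, C ≠ 0 ∧ C ≠ ⊤ ∧ ∀ (t : ℝ), t ≠ 0 → ∀ w : EuclideanSpace ℝ (Fin d),
      ∫⁻ v, ‖w + t • v‖ₑ ^ p ∂densityMeasure φ ≤ C * ‖w‖ₑ ^ p := by
  obtain ⟨A, hA, hφA⟩ := hφ.exists_le_norm_rpow
  have hprob := hφ.isProbabilityMeasure
  set c := ∫⁻ y in Metric.ball (0 : EuclideanSpace ℝ (Fin d)) 1, ‖y‖ₑ ^ p with hc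
  have hcfin : c < ⊤ := lintegral_unitBall_enorm_rpow_lt_top hd hp
  have hC0 : (1 + ENNReal.ofReal A * c) * ENNReal.ofReal (2 ^ (-p)) ≠ 0 := by
    have : (0 : ℝ) < 2 ^ (-p) := by positivity
    simp [this]
  refine ⟨_, hC0, by finiteness, ?_⟩
  -- Scale one. Put `r = |w|/2`. Where `|w + v| ≥ r`, the kernel is at most `r^p`. Where `|w + v| <
  -- r`, necessarily `|v| ≥ r`, so `φ(v) ≤ A r^{-d}`, and the integral of `|y|^p` over the ball of
  -- radius `r` is `c r^{d+p}`. The total is `(1 + A c) r^p`.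
  have base : ∀ w : EuclideanSpace ℝ (Fin d), w ≠ 0 →
      ∫⁻ v, ‖w + v‖ₑ ^ p ∂densityMeasure φ ≤
        (1 + ENNReal.ofReal A * c) * ENNReal.ofReal (2 ^ (-p)) * ‖w‖ₑ ^ p := by
    intro w hw
    have hw' : 0 < ‖w‖ := norm_pos_iff.2 hw
    set r := ‖w‖ / 2 with hr
    have hr0 : 0 < r := by positivity
    have hind : Measurable ((Metric.ball (0 : EuclideanSpace ℝ (Fin d)) r).indicator
      fun y => ‖y‖ₑ ^ p) := Measurable.indicator (by fun_prop) measurableSet_ball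
    have hpt : ∀ v, ENNReal.ofReal (φ v) * ‖w + v‖ₑ ^ p ≤
        ENNReal.ofReal (φ v) * ENNReal.ofReal (r ^ p) + ENNReal.ofReal (A * r ^ (-(d : ℝ))) *
          (Metric.ball (0 : EuclideanSpace ℝ (Fin d)) r).indicator (fun y => ‖y‖ₑ ^ p) (w + v) := by
      intro v
      by_cases hv : w + v ∈ Metric.ball (0 : EuclideanSpace ℝ (Fin d)) r
      · rw [Set.indicator_of_mem hv]
        refine le_add_left (mul_le_mul_left (ENNReal.ofReal_le_ofReal ?_) _)
        rw [mem_ball_zero_iff] at hv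
        have hrv : r ≤ ‖v‖ := by
          have := norm_sub_le (w + v) v
          rw [add_sub_cancel_right] at this
          linarith
        have hv0 : v ≠ 0 := norm_pos_iff.1 (hr0.trans_le hrv)
        exact (hφA v hv0).trans (mul_le_mul_of_nonneg_left
          (Real.rpow_le_rpow_of_nonpos hr0 hrv (by simp)) hA.le)
      · refine le_add_right (mul_le_mul_right ?_ _)
        rw [mem_ball_zero_iff, not_lt] at hv
        rw [enorm_rpow_of_ne_zero (norm_pos_iff.1 (hr0.trans_le hv))]
        exact ENNReal.ofReal_le_ofReal (Real.rpow_le_rpow_of_nonpos hr0 hv hp0.le)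
    rw [lintegral_densityMeasure hφ.measurable (by fun_prop)]
    refine (lintegral_mono hpt).trans_eq ?_
    rw [lintegral_add_right _ (by fun_prop), lintegral_const_mul _ (by fun_prop),
      lintegral_add_left_eq_self (μ := volume)
        ((Metric.ball (0 : EuclideanSpace ℝ (Fin d)) r).indicator fun y => ‖y‖ₑ ^ p) w,
      lintegral_indicator measurableSet_ball, lintegral_ball_enorm_rpow hr0, ← hc,
      ← lintegral_densityMeasure hφ.measurable (f := fun _ => ENNReal.ofReal (r ^ p)) (by fun_prop),
      lintegral_const, measure_univ, mul_one, ← mul_assoc, ← ENNReal.ofReal_mul (by positivity)]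
    have h1 : A * r ^ (-(d : ℝ)) * r ^ ((d : ℝ) + p) = A * r ^ p := by
      rw [mul_assoc, ← Real.rpow_add hr0]
      congr 2
      ring
    have h2 : ENNReal.ofReal (r ^ p) = ENNReal.ofReal (2 ^ (-p)) * ‖w‖ₑ ^ p := by
      rw [enorm_rpow_of_ne_zero hw, ← ENNReal.ofReal_mul (by positivity), hr,
        Real.div_rpow hw'.le (by norm_num), Real.rpow_neg (by norm_num)]
      congr 1
      field_simp
    rw [h1, ENNReal.ofReal_mul hA.le, h2]
    ring
  intro t ht w
  rcases eq_or_ne w 0 with rfl | hw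
  · rw [enorm_zero, ENNReal.zero_rpow_of_neg hp0, ENNReal.mul_top hC0]
    exact le_top
  -- Both sides are homogeneous of degree `p`, so scale `t` at `w` reduces to scale one at `t⁻¹ w`.
  have hsm : ∀ u : EuclideanSpace ℝ (Fin d), ‖t • u‖ₑ ^ p = ‖t‖ₑ ^ p * ‖u‖ₑ ^ p := by
    intro u
    rw [enorm_smul, ENNReal.mul_rpow_of_ne_top (by simp) (by simp)]
  have hsplit : ∀ v, ‖w + t • v‖ₑ ^ p = ‖t‖ₑ ^ p * ‖t⁻¹ • w + v‖ₑ ^ p := by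
    intro v
    rw [← hsm, smul_add, smul_inv_smul₀ ht]
  simp_rw [hsplit]
  rw [lintegral_const_mul _ (by fun_prop)]
  refine (mul_le_mul_right (base (t⁻¹ • w) (smul_ne_zero (inv_ne_zero ht) hw)) _).trans_eq ?_
  rw [mul_left_comm, ← hsm, smul_inv_smul₀ ht]

/-- Convergence of Riesz potentials along random points with a uniform bound on a more singular
Riesz potential. -/
theorem tendsto_lintegral_enorm_rpow_of_bound {Ω E ι : Type*} [MeasurableSpace Ω]
    [NormedAddCommGroup E] [MeasurableSpace E] [BorelSpace E] {Q : Measure Ω}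
    [IsProbabilityMeasure Q] {l : Filter ι} [l.IsCountablyGenerated] {X : ι → Ω → E} {z : E}
    (hX : ∀ i, Measurable (X i)) (hz : z ≠ 0) (hlim : ∀ η, Tendsto (fun i => X i η) l (𝓝 z))
    {p p' : ℝ} (hp : p < 0) (hpp : p' < p) {D : ℝ≥0∞} (hD : D ≠ ⊤)
    (hbound : ∀ᶠ i in l, ∫⁻ η, ‖X i η‖ₑ ^ p' ∂Q ≤ D) :
    Tendsto (fun i => ∫⁻ η, ‖X i η‖ₑ ^ p ∂Q) l (𝓝 (‖z‖ₑ ^ p)) := by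
  have hcont : ∀ s : ℝ, Continuous fun x : E => ‖x‖ₑ ^ s :=
    fun s => ENNReal.continuous_rpow_const.comp continuous_enorm
  rcases l.eq_or_neBot with rfl | hl
  · simp
  have hz0 : ‖z‖ₑ ≠ 0 := by simpa using hz
  -- Truncating the kernel at height `a^p` leaves a bounded integrand, whose integrals converge. The
  -- excess lives on `|X| ≤ a`, where `|X|^p ≤ a^{p-p'} |X|^{p'}`; it vanishes as `a → 0` since `p'
  -- < p`. The matching lower bound is Fatou's lemma.
  have hup : ∀ a : ℝ≥0∞, a ≠ 0 → a < ‖z‖ₑ →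
      limsup (fun i => ∫⁻ η, ‖X i η‖ₑ ^ p ∂Q) l ≤ ‖z‖ₑ ^ p + a ^ (p - p') * D := by
    intro a ha haz
    have hat : a ≠ ⊤ := haz.ne_top
    have htrunc : Tendsto (fun i => ∫⁻ η, min (‖X i η‖ₑ ^ p) (a ^ p) ∂Q) l (𝓝 (‖z‖ₑ ^ p)) := by
      have hfin : ∫⁻ _, a ^ p ∂Q ≠ ⊤ := by
        rw [lintegral_const, measure_univ, mul_one]
        exact ENNReal.rpow_ne_top_of_ne_zero ha hat
      have h := tendsto_lintegral_filter_of_dominated_convergence (μ := Q) (l := l)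
        (F := fun i η => min (‖X i η‖ₑ ^ p) (a ^ p))
        (f := fun _ => min (‖z‖ₑ ^ p) (a ^ p)) (fun _ => a ^ p)
        (Eventually.of_forall fun i => ((hcont p).measurable.comp (hX i)).min measurable_const)
        (Eventually.of_forall fun i => Eventually.of_forall fun η => min_le_right _ _) hfin
        (Eventually.of_forall fun η =>
          (((hcont p).tendsto z).comp (hlim η)).min tendsto_const_nhds)
      rw [lintegral_const, measure_univ, mul_one,
        min_eq_left (ennreal_rpow_le_rpow_of_nonpos hp.le haz.le)] at h
      exact h
    have hle : ∀ᶠ i in l, ∫⁻ η, ‖X i η‖ₑ ^ p ∂Q ≤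
        ∫⁻ η, min (‖X i η‖ₑ ^ p) (a ^ p) ∂Q + a ^ (p - p') * D := by
      filter_upwards [hbound] with i hi
      have hpt : ∀ x : E, ‖x‖ₑ ^ p ≤ min (‖x‖ₑ ^ p) (a ^ p) + a ^ (p - p') * ‖x‖ₑ ^ p' := by
        intro x
        rcases le_total a ‖x‖ₑ with hx | hx
        · rw [min_eq_left (ennreal_rpow_le_rpow_of_nonpos hp.le hx)]
          exact le_self_add
        · refine le_add_left ?_
          rcases eq_or_ne x 0 with rfl | hx0
          · rw [enorm_zero, ENNReal.zero_rpow_of_neg (hpp.trans hp), ENNReal.mul_top]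
            · exact le_top
            · exact (ENNReal.rpow_pos (pos_iff_ne_zero.2 ha) hat).ne'
          · calc ‖x‖ₑ ^ p = ‖x‖ₑ ^ (p - p') * ‖x‖ₑ ^ p' := by
                  rw [← ENNReal.rpow_add _ _ (by simpa using hx0) (by simp), sub_add_cancel]
              _ ≤ _ := mul_le_mul_left (ENNReal.rpow_le_rpow hx (by linarith)) _
      refine (lintegral_mono fun η => hpt (X i η)).trans ?_
      have hm : ∀ s : ℝ, Measurable fun η => ‖X i η‖ₑ ^ s :=
        fun s => (hcont s).measurable.comp (hX i)
      rw [lintegral_add_left ((hm p).min measurable_const), lintegral_const_mul _ (hm p')]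
      gcongr
    calc limsup (fun i => ∫⁻ η, ‖X i η‖ₑ ^ p ∂Q) l
        ≤ limsup (fun i => ∫⁻ η, min (‖X i η‖ₑ ^ p) (a ^ p) ∂Q + a ^ (p - p') * D) l :=
          limsup_le_limsup hle
      _ = _ := (htrunc.add tendsto_const_nhds).limsup_eq
  refine tendsto_of_le_liminf_of_limsup_le ?_ ?_
  · calc ‖z‖ₑ ^ p = ∫⁻ _, ‖z‖ₑ ^ p ∂Q := by simp
      _ = ∫⁻ η, liminf (fun i => ‖X i η‖ₑ ^ p) l ∂Q :=
          lintegral_congr fun η => ((((hcont p).tendsto z).comp (hlim η)).liminf_eq).symm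
      _ ≤ _ := lintegral_liminf_le fun i => (hcont p).measurable.comp (hX i)
  · have hlim0 : Tendsto (fun a : ℝ≥0∞ => ‖z‖ₑ ^ p + a ^ (p - p') * D) (𝓝[>] 0)
        (𝓝 (‖z‖ₑ ^ p)) := by
      have h0 : Tendsto (fun a : ℝ≥0∞ => a ^ (p - p')) (𝓝[>] 0) (𝓝 0) := by
        have h := (ENNReal.continuous_rpow_const (y := p - p')).tendsto 0
        rw [ENNReal.zero_rpow_of_pos (by linarith)] at h
        exact h.mono_left nhdsWithin_le_nhds
      simpa using tendsto_const_nhds.add (ENNReal.Tendsto.mul_const h0 (Or.inr hD))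
    refine ge_of_tendsto hlim0 ?_
    filter_upwards [self_mem_nhdsWithin,
      mem_nhdsWithin_of_mem_nhds (Iio_mem_nhds (pos_iff_ne_zero.2 hz0))] with a ha1 ha2
    exact hup a (ne_of_gt ha1) ha2

/-! ### The power-law kernel and its regularized energies -/

theorem powerKernel_eq (d : ℕ) {p q : ℝ} (hp : p < 0) (hq : 0 < q)
    (x : EuclideanSpace ℝ (Fin d)) :
    powerKernel d p q x =
      ENNReal.ofReal (1 / q) * ‖x‖ₑ ^ q + ENNReal.ofReal (1 / -p) * ‖x‖ₑ ^ p := by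
  have hp' : 0 < 1 / -p := one_div_pos.2 (neg_pos.2 hp)
  rw [powerKernel]
  split_ifs with hx
  · rw [hx, enorm_zero, ENNReal.zero_rpow_of_neg hp, ENNReal.mul_top (by simpa using hp),
      add_top]
  · rw [enorm_rpow_of_ne_zero hx, enorm_rpow_of_ne_zero hx, ← ENNReal.ofReal_mul (by positivity),
      ← ENNReal.ofReal_mul hp'.le, ← ENNReal.ofReal_add (by positivity) (by positivity)]
    congr 1
    field_simp
    ring

/-- In `[0,∞]` the convention `0^p = ⊤` for `p < 0` is the continuous extension, so the singularity
needs no separate treatment in the lower bound. -/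
theorem continuous_powerKernel (d : ℕ) {p q : ℝ} (hp : p < 0) (hq : 0 < q) :
    Continuous (powerKernel d p q) := by
  have hcont : ∀ s : ℝ, Continuous fun x : EuclideanSpace ℝ (Fin d) => ‖x‖ₑ ^ s :=
    fun s => ENNReal.continuous_rpow_const.comp continuous_enorm
  rw [funext (powerKernel_eq d hp hq)]
  exact (ENNReal.continuous_const_mul ENNReal.ofReal_ne_top |>.comp (hcont q)).add
    (ENNReal.continuous_const_mul ENNReal.ofReal_ne_top |>.comp (hcont p))

theorem measurable_regKernel {d : ℕ} {φ : EuclideanSpace ℝ (Fin d) → ℝ} (hφ : Measurable φ)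
    {K : EuclideanSpace ℝ (Fin d) → ℝ≥0∞} (hK : Measurable K) (ε : ℝ) :
    Measurable (regKernel φ K ε) := by
  have hr : Measurable fun x => ENNReal.ofReal (rescale φ ε x) := by unfold rescale; fun_prop
  exact measurable_lconvolution _ hr (measurable_lconvolution _ hK hr)

theorem isProbabilityMeasure_meas {d : ℕ} (μ : P2 d) : IsProbabilityMeasure μ.meas := μ.1.2

theorem interactionEnergy_eq_lintegral_prod {d : ℕ} {K : EuclideanSpace ℝ (Fin d) → ℝ≥0∞}
    (hK : Measurable K) (μ : P2 d) :
    interactionEnergy K μ = ∫⁻ z, K (z.2 - z.1) ∂(μ.meas.prod μ.meas) := by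
  have := isProbabilityMeasure_meas μ
  rw [lintegral_prod _ (by fun_prop), interactionEnergy]

theorem interactionEnergy_regKernel {d : ℕ} {φ : EuclideanSpace ℝ (Fin d) → ℝ}
    (hφ : Measurable φ) {K : EuclideanSpace ℝ (Fin d) → ℝ≥0∞} (hK : Measurable K) {ε : ℝ}
    (hε : 0 < ε) (μ : P2 d) :
    interactionEnergy (regKernel φ K ε) μ =
      ∫⁻ z, K (z.1.2 - z.1.1 - ε • z.2.1 - ε • z.2.2)
        ∂((μ.meas.prod μ.meas).prod ((densityMeasure φ).prod (densityMeasure φ))) := by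
  have := isProbabilityMeasure_meas μ
  rw [lintegral_prod _ (by fun_prop), interactionEnergy_eq_lintegral_prod
    (measurable_regKernel hφ hK ε)]
  refine lintegral_congr fun z => ?_
  rw [lintegral_prod _ (by fun_prop), regKernel_eq hφ hK hε]

/-- The limit is the Dirac mass at the origin, written as the member `ε = 0` of the same family.
Dominated convergence on the original law proves it. -/
theorem tendsto_map_smul {E : Type*} [NormedAddCommGroup E] [NormedSpace ℝ E] [MeasurableSpace E]
    [BorelSpace E] (ρ : ProbabilityMeasure E) :
    Tendsto (fun ε : ℝ => ρ.map (f := fun x : E => ε • x)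
      (continuous_const_smul ε).measurable.aemeasurable) (𝓝[>] 0)
      (𝓝 (ρ.map (f := fun x : E => (0 : ℝ) • x)
        (continuous_const_smul (0 : ℝ)).measurable.aemeasurable)) := by
  rw [ProbabilityMeasure.tendsto_iff_forall_lintegral_tendsto]
  intro f
  have hfm : Measurable fun x : E => (f x : ℝ≥0∞) :=
    (ENNReal.continuous_coe.comp f.continuous).measurable
  have hmap : ∀ ε : ℝ, ∫⁻ x, (f x : ℝ≥0∞) ∂((ρ.map (f := fun x : E => ε • x)
      (continuous_const_smul ε).measurable.aemeasurable : ProbabilityMeasure E) : Measure E) =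
      ∫⁻ x, (f (ε • x) : ℝ≥0∞) ∂(ρ : Measure E) := by
    intro ε
    rw [ProbabilityMeasure.toMeasure_map, lintegral_map hfm (continuous_const_smul ε).measurable]
  simp_rw [hmap]
  refine tendsto_lintegral_filter_of_dominated_convergence (fun _ => (nndist f 0 : ℝ≥0∞))
    (Eventually.of_forall fun ε => hfm.comp (continuous_const_smul ε).measurable)
    (Eventually.of_forall fun ε => Eventually.of_forall fun x => ?_) (by simp)
    (Eventually.of_forall fun x => ?_)
  · exact ENNReal.coe_le_coe.2 (BoundedContinuousFunction.NNReal.upper_bound f _)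
  · have hc : Continuous fun ε : ℝ => (f (ε • x) : ℝ≥0∞) :=
      ENNReal.continuous_coe.comp (f.continuous.comp (continuous_id.smul continuous_const))
    exact (hc.tendsto 0).mono_left nhdsWithin_le_nhds

/-- The `Γ`-liminf inequality, for any continuous nonnegative kernel. -/
theorem interactionEnergy_le_liminf {d : ℕ} {φ : EuclideanSpace ℝ (Fin d) → ℝ}
    (hφ : IsAdmissibleMollifier φ) {K : EuclideanSpace ℝ (Fin d) → ℝ≥0∞} (hK : Continuous K)
    (μs : ℝ → P2 d) (μ : P2 d) (h : Tendsto (fun ε => dW (μs ε) μ) (𝓝[>] 0) (𝓝 0)) :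
    interactionEnergy K μ ≤
      liminf (fun ε => interactionEnergy (regKernel φ K ε) (μs ε)) (𝓝[>] 0) := by
  have hprob := hφ.isProbabilityMeasure
  let ρ : ProbabilityMeasure (EuclideanSpace ℝ (Fin d)) := ⟨densityMeasure φ, hprob⟩
  let ρε : ℝ → ProbabilityMeasure (EuclideanSpace ℝ (Fin d)) := fun ε =>
    ρ.map (f := fun x => ε • x) (continuous_const_smul ε).measurable.aemeasurable
  have hw : Tendsto (fun ε => (((μs ε).1.prod (μs ε).1).prod ((ρε ε).prod (ρε ε)))) (𝓝[>] 0)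
      (𝓝 ((μ.1.prod μ.1).prod ((ρε 0).prod (ρε 0)))) := by
    have h1 := tendsto_probabilityMeasure_of_dW h
    have h2 : Tendsto ρε (𝓝[>] 0) (𝓝 (ρε 0)) := tendsto_map_smul ρ
    have hp1 := (ProbabilityMeasure.continuous_prod.tendsto (μ.1, μ.1)).comp (h1.prodMk_nhds h1)
    have hp2 := (ProbabilityMeasure.continuous_prod.tendsto (ρε 0, ρε 0)).comp (h2.prodMk_nhds h2)
    exact (ProbabilityMeasure.continuous_prod.tendsto _).comp (hp1.prodMk_nhds hp2)
  have hlsc := lintegral_le_liminf_of_tendsto_probabilityMeasure hw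
    (K := fun z => K (z.1.2 - z.1.1 - z.2.1 - z.2.2)) (by fun_prop)
  have hform : ∀ (ν : P2 d) (ε : ℝ),
      ∫⁻ z, K (z.1.2 - z.1.1 - z.2.1 - z.2.2)
        ∂((ν.1.prod ν.1).prod ((ρε ε).prod (ρε ε))).toMeasure =
      ∫⁻ z, K (z.1.2 - z.1.1 - ε • z.2.1 - ε • z.2.2)
        ∂((ν.meas.prod ν.meas).prod ((densityMeasure φ).prod (densityMeasure φ))) := by
    intro ν ε
    have := isProbabilityMeasure_meas ν
    have hρ : (ρε ε : Measure (EuclideanSpace ℝ (Fin d))) =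
      (densityMeasure φ).map (fun x => ε • x) := rfl
    have hm := hK.measurable
    rw [ProbabilityMeasure.toMeasure_prod, ProbabilityMeasure.toMeasure_prod,
      ProbabilityMeasure.toMeasure_prod, hρ,
      Measure.map_prod_map _ _ (by fun_prop) (by fun_prop)]
    refine (lintegral_prod _ (by fun_prop)).trans
      ((lintegral_congr fun z => ?_).trans (lintegral_prod _ (by fun_prop)).symm)
    rw [lintegral_map (by fun_prop) (by fun_prop)]
    rfl
  simp_rw [hform] at hlsc
  have h0 : ∫⁻ z, K (z.1.2 - z.1.1 - (0 : ℝ) • z.2.1 - (0 : ℝ) • z.2.2)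
        ∂((μ.meas.prod μ.meas).prod ((densityMeasure φ).prod (densityMeasure φ))) =
      interactionEnergy K μ := by
    have hm := hK.measurable
    have := isProbabilityMeasure_meas μ
    rw [lintegral_prod _ (by fun_prop), interactionEnergy_eq_lintegral_prod hm]
    simp
  rw [h0] at hlsc
  refine hlsc.trans_eq (liminf_congr ?_)
  filter_upwards [self_mem_nhdsWithin] with ε hε
  exact (interactionEnergy_regKernel hφ.measurable hK.measurable hε _).symm

/-! ### Energies of mollified measures -/

theorem measConv_eq {d : ℕ} (μ : Measure (EuclideanSpace ℝ (Fin d)))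
    (φ : EuclideanSpace ℝ (Fin d) → ℝ) : measConv μ φ = μ.conv (densityMeasure φ) := rfl

theorem lintegral_measConv_rescale {d : ℕ} (μ : Measure (EuclideanSpace ℝ (Fin d)))
    {ψ : EuclideanSpace ℝ (Fin d) → ℝ} (hψ : Measurable ψ) {δ : ℝ} (hδ : 0 < δ)
    {f : EuclideanSpace ℝ (Fin d) → ℝ≥0∞} (hf : Measurable f) :
    ∫⁻ x, f x ∂measConv μ (rescale ψ δ) = ∫⁻ x, ∫⁻ u, f (x + δ • u) ∂densityMeasure ψ ∂μ := by
  rw [measConv_eq, Measure.lintegral_conv hf]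
  refine lintegral_congr fun x => ?_
  rw [lintegral_densityMeasure_rescale hψ hδ (by fun_prop)]

/-- The displacement of `z` by two increments of size `δ` and two of size `ε`. -/
def displace {E : Type*} [AddCommGroup E] [Module ℝ E] (δ ε : ℝ) (z : E)
    (w : (E × E) × (E × E)) : E :=
  z + δ • w.1.2 + (-δ) • w.1.1 + (-ε) • w.2.1 + (-ε) • w.2.2

theorem measurable_displace {E : Type*} [NormedAddCommGroup E] [NormedSpace ℝ E]
    [MeasurableSpace E] [BorelSpace E] [SecondCountableTopology E] (δ ε : ℝ) (z : E) :
    Measurable (displace δ ε z) := by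
  unfold displace; fun_prop

theorem tendsto_displace {E ι : Type*} [NormedAddCommGroup E] [NormedSpace ℝ E] {l : Filter ι}
    {δ ε : ι → ℝ} (hδ : Tendsto δ l (𝓝 0)) (hε : Tendsto ε l (𝓝 0)) (z : E)
    (w : (E × E) × (E × E)) : Tendsto (fun i => displace (δ i) (ε i) z w) l (𝓝 z) := by
  have h := ((((tendsto_const_nhds (x := z)).add (hδ.smul_const w.1.2)).add
    (hδ.neg.smul_const w.1.1)).add (hε.neg.smul_const w.2.1)).add (hε.neg.smul_const w.2.2)
  simpa [displace] using h

theorem ennreal_add_sq_le (a b : ℝ≥0∞) : (a + b) ^ 2 ≤ 2 * (a ^ 2 + b ^ 2) := by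
  have h := ENNReal.rpow_add_le_mul_rpow_add_rpow a b (p := 2) (by norm_num)
  simpa [show (2 : ℝ) - 1 = 1 by norm_num] using h

theorem ennreal_rpow_le_one_add_sq {q : ℝ} (hq : 0 < q) (hq2 : q ≤ 2) (a : ℝ≥0∞) :
    a ^ q ≤ 1 + a ^ 2 := by
  rcases le_total a 1 with ha | ha
  · exact le_add_right (ENNReal.rpow_le_one ha hq.le)
  · refine le_add_left ?_
    rw [← ENNReal.rpow_natCast]
    exact ENNReal.rpow_le_rpow_of_exponent_le ha (by simpa using hq2)

/-- The sum of squares of the increments. -/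
noncomputable def sqSum {E : Type*} [NormedAddCommGroup E] (w : (E × E) × (E × E)) : ℝ≥0∞ :=
  (‖w.1.1‖ₑ ^ 2 + ‖w.1.2‖ₑ ^ 2) + (‖w.2.1‖ₑ ^ 2 + ‖w.2.2‖ₑ ^ 2)

/-- A majorant free of `δ` and `ε`, from `a^q ≤ 1 + a²` and `(a + b)² ≤ 2(a² + b²)`. The latter is
used once to detach `z` and at two further levels for the four increments, whence `8 = 2³`. -/
theorem enorm_displace_rpow_le {E : Type*} [NormedAddCommGroup E] [NormedSpace ℝ E] {δ ε : ℝ}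
    (hδ : |δ| ≤ 1) (hε : |ε| ≤ 1) {q : ℝ} (hq : 0 < q) (hq2 : q ≤ 2) (z : E)
    (w : (E × E) × (E × E)) :
    ‖displace δ ε z w‖ₑ ^ q ≤ 1 + 2 * ‖z‖ₑ ^ 2 + 8 * sqSum w := by
  have hsm : ∀ (t : ℝ) (u : E), |t| ≤ 1 → ‖t • u‖ₑ ≤ ‖u‖ₑ := by
    intro t u ht
    rw [enorm_le_iff_norm_le, norm_smul, Real.norm_eq_abs]
    exact mul_le_of_le_one_left (norm_nonneg _) ht
  have h1 : ‖displace δ ε z w‖ₑ ≤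
      ‖z‖ₑ + ((‖w.1.1‖ₑ + ‖w.1.2‖ₑ) + (‖w.2.1‖ₑ + ‖w.2.2‖ₑ)) := by
    have he : displace δ ε z w =
      z + (((-δ) • w.1.1 + δ • w.1.2) + ((-ε) • w.2.1 + (-ε) • w.2.2)) := by
      unfold displace; abel
    rw [he]
    refine (enorm_add_le _ _).trans (add_le_add le_rfl ?_)
    refine (enorm_add_le _ _).trans (add_le_add ?_ ?_)
    · exact (enorm_add_le _ _).trans
        (add_le_add (hsm _ _ (by rwa [abs_neg])) (hsm _ _ hδ))
    · exact (enorm_add_le _ _).trans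
        (add_le_add (hsm _ _ (by rwa [abs_neg])) (hsm _ _ (by rwa [abs_neg])))
  refine (ennreal_rpow_le_one_add_sq hq hq2 _).trans ?_
  rw [add_assoc]
  refine add_le_add le_rfl ((pow_le_pow_left' h1 2).trans ((ennreal_add_sq_le _ _).trans ?_))
  rw [mul_add]
  refine add_le_add le_rfl ?_
  calc 2 * ((‖w.1.1‖ₑ + ‖w.1.2‖ₑ) + (‖w.2.1‖ₑ + ‖w.2.2‖ₑ)) ^ 2
      ≤ 2 * (2 * (2 * (‖w.1.1‖ₑ ^ 2 + ‖w.1.2‖ₑ ^ 2) + 2 * (‖w.2.1‖ₑ ^ 2 + ‖w.2.2‖ₑ ^ 2))) := by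
        refine mul_le_mul_right ((ennreal_add_sq_le _ _).trans (mul_le_mul_right ?_ _)) _
        exact add_le_add (ennreal_add_sq_le _ _) (ennreal_add_sq_le _ _)
    _ = 8 * sqSum w := by unfold sqSum; ring

/-- The law of the increments: two independent ones from `ψ` and two from `φ`. -/
noncomputable def incrementLaw {d : ℕ} (ψ φ : EuclideanSpace ℝ (Fin d) → ℝ) :
    Measure ((EuclideanSpace ℝ (Fin d) × EuclideanSpace ℝ (Fin d)) ×
      (EuclideanSpace ℝ (Fin d) × EuclideanSpace ℝ (Fin d))) :=
  ((densityMeasure ψ).prod (densityMeasure ψ)).prod ((densityMeasure φ).prod (densityMeasure φ))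

theorem isProbabilityMeasure_incrementLaw {d : ℕ} {ψ φ : EuclideanSpace ℝ (Fin d) → ℝ}
    (hψ : IsAdmissibleMollifier ψ) (hφ : IsAdmissibleMollifier φ) :
    IsProbabilityMeasure (incrementLaw ψ φ) := by
  have := hψ.isProbabilityMeasure
  have := hφ.isProbabilityMeasure
  unfold incrementLaw
  infer_instance

theorem lintegral_incrementLaw {d : ℕ} (ψ φ : EuclideanSpace ℝ (Fin d) → ℝ)
    {f : (EuclideanSpace ℝ (Fin d) × EuclideanSpace ℝ (Fin d)) ×
      (EuclideanSpace ℝ (Fin d) × EuclideanSpace ℝ (Fin d)) → ℝ≥0∞} (hf : Measurable f) :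
    ∫⁻ w, f w ∂incrementLaw ψ φ =
      ∫⁻ u', ∫⁻ u, ∫⁻ a, ∫⁻ c, f ((u', u), (a, c))
        ∂densityMeasure φ ∂densityMeasure φ ∂densityMeasure ψ ∂densityMeasure ψ := by
  rw [incrementLaw, lintegral_prod _ hf.aemeasurable, lintegral_prod _ (by fun_prop)]
  refine lintegral_congr fun u' => lintegral_congr fun u => ?_
  rw [lintegral_prod _ (by fun_prop)]

theorem measurable_sqSum {E : Type*} [NormedAddCommGroup E] [MeasurableSpace E] [BorelSpace E]
    [SecondCountableTopology E] : Measurable (sqSum (E := E)) := by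
  unfold sqSum; fun_prop

theorem lintegral_sqSum_lt_top {d : ℕ} (hd : 2 ≤ d) {ψ φ : EuclideanSpace ℝ (Fin d) → ℝ}
    (hψ : IsAdmissibleMollifier ψ) (hφ : IsAdmissibleMollifier φ) :
    ∫⁻ w, sqSum w ∂incrementLaw ψ φ < ⊤ := by
  have := hψ.isProbabilityMeasure
  have := hφ.isProbabilityMeasure
  have h1 := hψ.lintegral_enorm_sq_lt_top hd
  have h2 := hφ.lintegral_enorm_sq_lt_top hd
  rw [lintegral_incrementLaw _ _ measurable_sqSum]
  have hadd : ∀ (ρ : Measure (EuclideanSpace ℝ (Fin d))) (c : ℝ≥0∞)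
      (f : EuclideanSpace ℝ (Fin d) → ℝ≥0∞), IsProbabilityMeasure ρ →
      ∫⁻ x, (c + f x) ∂ρ = c + ∫⁻ x, f x ∂ρ := by
    intro ρ c f _
    rw [lintegral_add_left measurable_const, lintegral_const, measure_univ, mul_one]
  have hadd' : ∀ (ρ : Measure (EuclideanSpace ℝ (Fin d))) (c : ℝ≥0∞)
      (f : EuclideanSpace ℝ (Fin d) → ℝ≥0∞), IsProbabilityMeasure ρ →
      ∫⁻ x, (f x + c) ∂ρ = (∫⁻ x, f x ∂ρ) + c := by
    intro ρ c f _
    rw [lintegral_add_right _ measurable_const, lintegral_const, measure_univ, mul_one]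
  simp only [sqSum, hadd _ _ _ hφ.isProbabilityMeasure, hadd' _ _ _ hφ.isProbabilityMeasure,
    hadd _ _ _ hψ.isProbabilityMeasure, hadd' _ _ _ hψ.isProbabilityMeasure]
  finiteness

/-- The average of `K` over the displacements of `z`. -/
noncomputable def smear {d : ℕ} (ψ φ : EuclideanSpace ℝ (Fin d) → ℝ)
    (K : EuclideanSpace ℝ (Fin d) → ℝ≥0∞) (δ ε : ℝ) (z : EuclideanSpace ℝ (Fin d)) : ℝ≥0∞ :=
  ∫⁻ w, K (displace δ ε z w) ∂incrementLaw ψ φ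

theorem smear_eq {d : ℕ} (ψ φ : EuclideanSpace ℝ (Fin d) → ℝ)
    {K : EuclideanSpace ℝ (Fin d) → ℝ≥0∞} (hK : Measurable K) (δ ε : ℝ)
    (z : EuclideanSpace ℝ (Fin d)) :
    smear ψ φ K δ ε z = ∫⁻ u', ∫⁻ u, ∫⁻ a, ∫⁻ c, K (displace δ ε z ((u', u), (a, c)))
      ∂densityMeasure φ ∂densityMeasure φ ∂densityMeasure ψ ∂densityMeasure ψ :=
  lintegral_incrementLaw ψ φ (hK.comp (measurable_displace δ ε z))

theorem measurable_smear {d : ℕ} (ψ φ : EuclideanSpace ℝ (Fin d) → ℝ)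
    {K : EuclideanSpace ℝ (Fin d) → ℝ≥0∞} (hK : Measurable K) (δ ε : ℝ) :
    Measurable (smear ψ φ K δ ε) := by
  have : SFinite (incrementLaw ψ φ) := by unfold incrementLaw; infer_instance
  have h : Measurable fun x : EuclideanSpace ℝ (Fin d) ×
      ((EuclideanSpace ℝ (Fin d) × EuclideanSpace ℝ (Fin d)) ×
      (EuclideanSpace ℝ (Fin d) × EuclideanSpace ℝ (Fin d))) => K (displace δ ε x.1 x.2) := by
    unfold displace; fun_prop
  exact h.lintegral_prod_right'

/-- The regularized energy of a mollified measure is the energy of the smeared kernel. -/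
theorem interactionEnergy_regKernel_measConv {d : ℕ} {ψ φ : EuclideanSpace ℝ (Fin d) → ℝ}
    (hψ : Measurable ψ) (hφ : Measurable φ) {K : EuclideanSpace ℝ (Fin d) → ℝ≥0∞}
    (hK : Measurable K) {δ ε : ℝ} (hδ : 0 < δ) (hε : 0 < ε) {μ ν : P2 d}
    (hν : ν.meas = measConv μ.meas (rescale ψ δ)) :
    interactionEnergy (regKernel φ K ε) ν = interactionEnergy (smear ψ φ K δ ε) μ := by
  have := isProbabilityMeasure_meas μ
  have hH := measurable_regKernel hφ hK ε
  set H := regKernel φ K ε with hHdef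
  have : IsProbabilityMeasure (measConv μ.meas (rescale ψ δ)) := hν ▸ isProbabilityMeasure_meas ν
  rw [interactionEnergy, hν, lintegral_measConv_rescale _ hψ hδ
    (Measurable.lintegral_prod_right' (f := fun z => H (z.2 - z.1)) (by fun_prop)),
    interactionEnergy]
  refine lintegral_congr fun y => ?_
  have h1 : ∀ u', ∫⁻ x, H (x - (y + δ • u')) ∂measConv μ.meas (rescale ψ δ) =
      ∫⁻ x, ∫⁻ u, H (x + δ • u - (y + δ • u')) ∂densityMeasure ψ ∂μ.meas := fun u' =>
    lintegral_measConv_rescale _ hψ hδ (f := fun x => H (x - (y + δ • u'))) (by fun_prop)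
  simp_rw [h1]
  -- Tonelli exchanges `u'` with `x`, bringing both `μ`-integrals outside the increments.
  rw [lintegral_lintegral_swap]
  · refine lintegral_congr fun x => ?_
    rw [smear_eq _ _ hK]
    refine lintegral_congr fun u' => lintegral_congr fun u => ?_
    rw [hHdef, regKernel_eq hφ hK hε]
    refine lintegral_congr fun a => lintegral_congr fun c => ?_
    congr 1
    simp only [displace, neg_smul]
    abel
  · refine Measurable.aemeasurable ?_
    exact Measurable.lintegral_prod_right' (f := fun z : (EuclideanSpace ℝ (Fin d) ×
      EuclideanSpace ℝ (Fin d)) × EuclideanSpace ℝ (Fin d) =>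
      H (z.1.2 + δ • z.2 - (y + δ • z.1.1))) (by fun_prop)

/-- The increments are integrated out one at a time, each costing the constant of its mollifier,
which does not depend on the scale. -/
theorem exists_smear_enorm_rpow_le {d : ℕ} (hd : 0 < d) {ψ φ : EuclideanSpace ℝ (Fin d) → ℝ}
    (hψ : IsAdmissibleMollifier ψ) (hφ : IsAdmissibleMollifier φ) {p : ℝ}
    (hp : -(d : ℝ) < p) (hp0 : p < 0) :
    ∃ C : ℝ≥0∞, C ≠ ⊤ ∧ ∀ δ ε : ℝ, δ ≠ 0 → ε ≠ 0 → ∀ z : EuclideanSpace ℝ (Fin d),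
      smear ψ φ (fun x => ‖x‖ₑ ^ p) δ ε z ≤ C * ‖z‖ₑ ^ p := by
  obtain ⟨A, -, hA, hψA⟩ := hψ.exists_lintegral_enorm_rpow_le hd hp hp0
  obtain ⟨B, -, hB, hφB⟩ := hφ.exists_lintegral_enorm_rpow_le hd hp hp0
  refine ⟨B * B * A * A, by finiteness, fun δ ε hδ hε z => ?_⟩
  have hε' : -ε ≠ 0 := neg_ne_zero.2 hε
  rw [smear_eq _ _ (by fun_prop)]
  have step : ∀ u' u : EuclideanSpace ℝ (Fin d),
      ∫⁻ a, ∫⁻ c, ‖displace δ ε z ((u', u), (a, c))‖ₑ ^ p ∂densityMeasure φ ∂densityMeasure φ ≤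
        B * B * ‖z + (-δ) • u' + δ • u‖ₑ ^ p := by
    intro u' u
    calc _ ≤ ∫⁻ a, B * ‖z + (-δ) • u' + δ • u + (-ε) • a‖ₑ ^ p ∂densityMeasure φ := by
          refine lintegral_mono fun a => ?_
          have := hφB (-ε) hε' (z + (-δ) • u' + δ • u + (-ε) • a)
          simpa only [displace, add_right_comm z] using this
      _ ≤ _ := by
          rw [lintegral_const_mul _ (by fun_prop), mul_assoc]
          exact mul_le_mul_right (hφB (-ε) hε' _) _
  calc _ ≤ ∫⁻ u', ∫⁻ u, B * B * ‖z + (-δ) • u' + δ • u‖ₑ ^ p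
          ∂densityMeasure ψ ∂densityMeasure ψ :=
        lintegral_mono fun u' => lintegral_mono fun u => step u' u
    _ ≤ ∫⁻ u', B * B * (A * ‖z + (-δ) • u'‖ₑ ^ p) ∂densityMeasure ψ := by
        refine lintegral_mono fun u' => ?_
        rw [lintegral_const_mul _ (by fun_prop)]
        exact mul_le_mul_right (hψA δ hδ _) _
    _ ≤ B * B * (A * (A * ‖z‖ₑ ^ p)) := by
        rw [lintegral_const_mul _ (by fun_prop), lintegral_const_mul _ (by fun_prop)]
        exact mul_le_mul_right (mul_le_mul_right (hψA (-δ) (neg_ne_zero.2 hδ) _) _) _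
    _ = _ := by ring

theorem exists_smear_enorm_rpow_le_of_pos {d : ℕ} (hd : 2 ≤ d)
    {ψ φ : EuclideanSpace ℝ (Fin d) → ℝ} (hψ : IsAdmissibleMollifier ψ)
    (hφ : IsAdmissibleMollifier φ) {q : ℝ} (hq : 0 < q) (hq2 : q ≤ 2) :
    ∃ C : ℝ≥0∞, C ≠ ⊤ ∧ ∀ δ ε : ℝ, |δ| ≤ 1 → |ε| ≤ 1 → ∀ z : EuclideanSpace ℝ (Fin d),
      smear ψ φ (fun x => ‖x‖ₑ ^ q) δ ε z ≤ C + 2 * ‖z‖ₑ ^ 2 := by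
  have := isProbabilityMeasure_incrementLaw hψ hφ
  have h8 := lintegral_sqSum_lt_top hd hψ hφ
  refine ⟨1 + 8 * ∫⁻ w, sqSum w ∂incrementLaw ψ φ, by finiteness, fun δ ε hδ hε z => ?_⟩
  refine (lintegral_mono fun w => enorm_displace_rpow_le hδ hε hq hq2 z w).trans_eq ?_
  rw [lintegral_add_left measurable_const, lintegral_const, measure_univ,
    lintegral_const_mul _ measurable_sqSum]
  ring

theorem tendsto_smear_enorm_rpow {d : ℕ} (hd : 0 < d) {ψ φ : EuclideanSpace ℝ (Fin d) → ℝ}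
    (hψ : IsAdmissibleMollifier ψ) (hφ : IsAdmissibleMollifier φ) {p : ℝ}
    (hp : -(d : ℝ) < p) (hp0 : p < 0) {ι : Type*} {l : Filter ι} [l.IsCountablyGenerated]
    {δ ε : ι → ℝ} (hδ : Tendsto δ l (𝓝 0)) (hε : Tendsto ε l (𝓝 0))
    (hδ0 : ∀ᶠ i in l, δ i ≠ 0) (hε0 : ∀ᶠ i in l, ε i ≠ 0) {z : EuclideanSpace ℝ (Fin d)}
    (hz : z ≠ 0) :
    Tendsto (fun i => smear ψ φ (fun x => ‖x‖ₑ ^ p) (δ i) (ε i) z) l (𝓝 (‖z‖ₑ ^ p)) := by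
  have := isProbabilityMeasure_incrementLaw hψ hφ
  -- The midpoint of `-d` and `p` is more singular than `p`, yet still in the range of the uniform
  -- Riesz bound.
  obtain ⟨C, hC, hbd⟩ := exists_smear_enorm_rpow_le hd hψ hφ (p := (p - d) / 2) (by linarith)
    (by linarith)
  refine tendsto_lintegral_enorm_rpow_of_bound (D := C * ‖z‖ₑ ^ ((p - d) / 2))
    (fun i => measurable_displace (δ i) (ε i) z) hz (tendsto_displace hδ hε z) hp0
    (p' := (p - d) / 2) (by linarith) ?_ ?_
  · exact ENNReal.mul_ne_top hC (ENNReal.rpow_ne_top_of_ne_zero (by simpa using hz) (by simp))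
  · filter_upwards [hδ0, hε0] with i h1 h2
    exact hbd _ _ h1 h2 z

theorem tendsto_smear_enorm_rpow_of_pos {d : ℕ} (hd : 2 ≤ d)
    {ψ φ : EuclideanSpace ℝ (Fin d) → ℝ} (hψ : IsAdmissibleMollifier ψ)
    (hφ : IsAdmissibleMollifier φ) {q : ℝ} (hq : 0 < q) (hq2 : q ≤ 2) {ι : Type*} {l : Filter ι}
    [l.IsCountablyGenerated] {δ ε : ι → ℝ} (hδ : Tendsto δ l (𝓝 0)) (hε : Tendsto ε l (𝓝 0))
    (z : EuclideanSpace ℝ (Fin d)) :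
    Tendsto (fun i => smear ψ φ (fun x => ‖x‖ₑ ^ q) (δ i) (ε i) z) l (𝓝 (‖z‖ₑ ^ q)) := by
  have := isProbabilityMeasure_incrementLaw hψ hφ
  have h8 := lintegral_sqSum_lt_top hd hψ hφ
  have hcont : Continuous fun x : EuclideanSpace ℝ (Fin d) => ‖x‖ₑ ^ q :=
    ENNReal.continuous_rpow_const.comp continuous_enorm
  have hsmall : ∀ {f : ι → ℝ}, Tendsto f l (𝓝 0) → ∀ᶠ i in l, |f i| ≤ 1 := fun hf =>
    (by simpa using hf.abs : Tendsto _ l (𝓝 (0 : ℝ))).eventually (Iic_mem_nhds one_pos)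
  have hz : ‖z‖ₑ ^ q = ∫⁻ _, ‖z‖ₑ ^ q ∂incrementLaw ψ φ := by simp
  rw [hz]
  refine tendsto_lintegral_filter_of_dominated_convergence
    (fun w => 1 + 2 * ‖z‖ₑ ^ 2 + 8 * sqSum w)
    (Eventually.of_forall fun i => hcont.measurable.comp (measurable_displace _ _ z)) ?_ ?_
    (Eventually.of_forall fun w => (hcont.tendsto z).comp (tendsto_displace hδ hε z w))
  · filter_upwards [hsmall hδ, hsmall hε] with i h1 h2
    exact Eventually.of_forall fun w => enorm_displace_rpow_le h1 h2 hq hq2 z w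
  · rw [lintegral_add_left measurable_const, lintegral_const, measure_univ,
      lintegral_const_mul _ measurable_sqSum]
    finiteness

/-! ### The recovery family -/

theorem lintegral_prod_enorm_sub_sq_lt_top {d : ℕ} (μ : P2 d) :
    ∫⁻ z, ‖z.2 - z.1‖ₑ ^ 2 ∂(μ.meas.prod μ.meas) < ⊤ := by
  have := isProbabilityMeasure_meas μ
  have hμ : ∫⁻ x, ‖x‖ₑ ^ 2 ∂μ.meas < ⊤ := μ.2
  have hpt : ∀ z : EuclideanSpace ℝ (Fin d) × EuclideanSpace ℝ (Fin d),
      ‖z.2 - z.1‖ₑ ^ 2 ≤ 2 * (‖z.2‖ₑ ^ 2 + ‖z.1‖ₑ ^ 2) := fun z =>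
    (pow_le_pow_left' enorm_sub_le 2).trans (ennreal_add_sq_le _ _)
  refine (lintegral_mono hpt).trans_lt ?_
  rw [lintegral_const_mul _ (by fun_prop), lintegral_add_left (by fun_prop),
    measurePreserving_snd.lintegral_comp (f := fun x => ‖x‖ₑ ^ 2) (by fun_prop),
    measurePreserving_fst.lintegral_comp (f := fun x => ‖x‖ₑ ^ 2) (by fun_prop)]
  finiteness

theorem interactionEnergy_add_mul {d : ℕ} {f g : EuclideanSpace ℝ (Fin d) → ℝ≥0∞}
    (hf : Measurable f) (hg : Measurable g) (a b : ℝ≥0∞) (μ : P2 d) :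
    interactionEnergy (fun x => a * f x + b * g x) μ =
      a * interactionEnergy f μ + b * interactionEnergy g μ := by
  rw [interactionEnergy_eq_lintegral_prod (by fun_prop), interactionEnergy_eq_lintegral_prod hf,
    interactionEnergy_eq_lintegral_prod hg, lintegral_add_left (by fun_prop),
    lintegral_const_mul _ (by fun_prop), lintegral_const_mul _ (by fun_prop)]

theorem smear_add_mul {d : ℕ} (ψ φ : EuclideanSpace ℝ (Fin d) → ℝ)
    {f g : EuclideanSpace ℝ (Fin d) → ℝ≥0∞} (hf : Measurable f) (hg : Measurable g) (a b : ℝ≥0∞)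
    (δ ε : ℝ) (z : EuclideanSpace ℝ (Fin d)) :
    smear ψ φ (fun x => a * f x + b * g x) δ ε z =
      a * smear ψ φ f δ ε z + b * smear ψ φ g δ ε z := by
  have hf' := hf.comp (measurable_displace δ ε z)
  have hg' := hg.comp (measurable_displace δ ε z)
  exact (lintegral_add_left (hf'.const_mul a) _).trans
    (congrArg₂ _ (lintegral_const_mul _ hf') (lintegral_const_mul _ hg'))

/-- Finite Riesz energy plays two roles: it makes the majorant `C|x - y|^p` integrable, and it makes
the diagonal `μ ⊗ μ`-null, so that pointwise convergence off the origin suffices. -/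
theorem tendsto_interactionEnergy_smear_enorm_rpow {d : ℕ} (hd : 0 < d)
    {ψ φ : EuclideanSpace ℝ (Fin d) → ℝ} (hψ : IsAdmissibleMollifier ψ)
    (hφ : IsAdmissibleMollifier φ) {p : ℝ} (hp : -(d : ℝ) < p) (hp0 : p < 0) {ι : Type*}
    {l : Filter ι} [l.IsCountablyGenerated] {δ ε : ι → ℝ} (hδ : Tendsto δ l (𝓝 0))
    (hε : Tendsto ε l (𝓝 0)) (hδ0 : ∀ᶠ i in l, δ i ≠ 0) (hε0 : ∀ᶠ i in l, ε i ≠ 0) {μ : P2 d}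
    (hμ : interactionEnergy (fun x => ‖x‖ₑ ^ p) μ ≠ ⊤) :
    Tendsto (fun i => interactionEnergy (smear ψ φ (fun x => ‖x‖ₑ ^ p) (δ i) (ε i)) μ) l
      (𝓝 (interactionEnergy (fun x => ‖x‖ₑ ^ p) μ)) := by
  have hm : Measurable fun x : EuclideanSpace ℝ (Fin d) => ‖x‖ₑ ^ p := by fun_prop
  have hsm := fun i => measurable_smear ψ φ hm (δ i) (ε i)
  simp_rw [fun i => interactionEnergy_eq_lintegral_prod (hsm i) μ]
  rw [interactionEnergy_eq_lintegral_prod hm] at hμ ⊢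
  obtain ⟨C, hC, hbd⟩ := exists_smear_enorm_rpow_le hd hψ hφ hp hp0
  have hdiag : ∀ᵐ z ∂(μ.meas.prod μ.meas), z.2 - z.1 ≠ 0 := by
    filter_upwards [ae_lt_top (by fun_prop) hμ] with z hz h0
    rw [h0, enorm_zero, ENNReal.zero_rpow_of_neg hp0] at hz
    exact lt_irrefl _ hz
  refine tendsto_lintegral_filter_of_dominated_convergence (fun z => C * ‖z.2 - z.1‖ₑ ^ p)
    (Eventually.of_forall fun i => (hsm i).comp (by fun_prop)) ?_ ?_ ?_
  · filter_upwards [hδ0, hε0] with i h1 h2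
    exact Eventually.of_forall fun z => hbd _ _ h1 h2 _
  · rw [lintegral_const_mul _ (by fun_prop)]
    exact ENNReal.mul_ne_top hC hμ
  · filter_upwards [hdiag] with z hz
    exact tendsto_smear_enorm_rpow hd hψ hφ hp hp0 hδ hε hδ0 hε0 hz

/-- The majorant `C + 2|x - y|²` is integrable because `μ` has finite second moment. -/
theorem tendsto_interactionEnergy_smear_enorm_rpow_of_pos {d : ℕ} (hd : 2 ≤ d)
    {ψ φ : EuclideanSpace ℝ (Fin d) → ℝ} (hψ : IsAdmissibleMollifier ψ)
    (hφ : IsAdmissibleMollifier φ) {q : ℝ} (hq : 0 < q) (hq2 : q ≤ 2) {ι : Type*}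
    {l : Filter ι} [l.IsCountablyGenerated] {δ ε : ι → ℝ} (hδ : Tendsto δ l (𝓝 0))
    (hε : Tendsto ε l (𝓝 0)) (μ : P2 d) :
    Tendsto (fun i => interactionEnergy (smear ψ φ (fun x => ‖x‖ₑ ^ q) (δ i) (ε i)) μ) l
      (𝓝 (interactionEnergy (fun x => ‖x‖ₑ ^ q) μ)) := by
  have := isProbabilityMeasure_meas μ
  have hm : Measurable fun x : EuclideanSpace ℝ (Fin d) => ‖x‖ₑ ^ q := by fun_prop
  have hsm := fun i => measurable_smear ψ φ hm (δ i) (ε i)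
  simp_rw [fun i => interactionEnergy_eq_lintegral_prod (hsm i) μ]
  rw [interactionEnergy_eq_lintegral_prod hm]
  obtain ⟨C, hC, hbd⟩ := exists_smear_enorm_rpow_le_of_pos hd hψ hφ hq hq2
  have hsmall : ∀ {f : ι → ℝ}, Tendsto f l (𝓝 0) → ∀ᶠ i in l, |f i| ≤ 1 := fun hf =>
    (by simpa using hf.abs : Tendsto _ l (𝓝 (0 : ℝ))).eventually (Iic_mem_nhds one_pos)
  refine tendsto_lintegral_filter_of_dominated_convergence
    (fun z => C + 2 * ‖z.2 - z.1‖ₑ ^ 2)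
    (Eventually.of_forall fun i => (hsm i).comp (by fun_prop)) ?_ ?_
    (Eventually.of_forall fun z => tendsto_smear_enorm_rpow_of_pos hd hψ hφ hq hq2 hδ hε _)
  · filter_upwards [hsmall hδ, hsmall hε] with i h1 h2
    exact Eventually.of_forall fun z => hbd _ _ h1 h2 _
  · have := lintegral_prod_enorm_sub_sq_lt_top μ
    rw [lintegral_add_left measurable_const, lintegral_const, measure_univ,
      lintegral_const_mul _ (by fun_prop)]
    finiteness

theorem tendsto_interactionEnergy_smear_powerKernel {d : ℕ} (hd : 2 ≤ d)
    {ψ φ : EuclideanSpace ℝ (Fin d) → ℝ} (hψ : IsAdmissibleMollifier ψ)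
    (hφ : IsAdmissibleMollifier φ) {p q : ℝ} (hp : -(d : ℝ) < p) (hp0 : p < 0) (hq : 0 < q)
    (hq2 : q ≤ 2) {ι : Type*} {l : Filter ι} [l.IsCountablyGenerated] {δ ε : ι → ℝ}
    (hδ : Tendsto δ l (𝓝 0)) (hε : Tendsto ε l (𝓝 0)) (hδ0 : ∀ᶠ i in l, δ i ≠ 0)
    (hε0 : ∀ᶠ i in l, ε i ≠ 0) {μ : P2 d}
    (hμ : interactionEnergy (powerKernel d p q) μ ≠ ⊤) :
    Tendsto (fun i => interactionEnergy (smear ψ φ (powerKernel d p q) (δ i) (ε i)) μ) l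
      (𝓝 (interactionEnergy (powerKernel d p q) μ)) := by
  have hmq : Measurable fun x : EuclideanSpace ℝ (Fin d) => ‖x‖ₑ ^ q := by fun_prop
  have hmp : Measurable fun x : EuclideanSpace ℝ (Fin d) => ‖x‖ₑ ^ p := by fun_prop
  have hp' : ENNReal.ofReal (1 / -p) ≠ 0 := by simpa using hp0
  rw [funext (powerKernel_eq d hp0 hq), interactionEnergy_add_mul hmq hmp] at *
  have hμp : interactionEnergy (fun x => ‖x‖ₑ ^ p) μ ≠ ⊤ := by
    intro h
    rw [h, ENNReal.mul_top hp', add_top] at hμ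
    exact hμ rfl
  simp_rw [fun i => funext (smear_add_mul ψ φ hmq hmp (ENNReal.ofReal (1 / q))
      (ENNReal.ofReal (1 / -p)) (δ i) (ε i)), fun i => interactionEnergy_add_mul
      (measurable_smear ψ φ hmq (δ i) (ε i)) (measurable_smear ψ φ hmp (δ i) (ε i))]
  exact (ENNReal.Tendsto.const_mul (tendsto_interactionEnergy_smear_enorm_rpow_of_pos hd hψ hφ hq
      hq2 hδ hε μ) (Or.inr ENNReal.ofReal_ne_top)).add
    (ENNReal.Tendsto.const_mul (tendsto_interactionEnergy_smear_enorm_rpow (by omega) hψ hφ hp hp0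
      hδ hε hδ0 hε0 hμp) (Or.inr ENNReal.ofReal_ne_top))

theorem isProbabilityMeasure_measConv_rescale {d : ℕ} {ψ : EuclideanSpace ℝ (Fin d) → ℝ}
    (hψ : IsAdmissibleMollifier ψ) {δ : ℝ} (hδ : 0 < δ) (μ : P2 d) :
    IsProbabilityMeasure (measConv μ.meas (rescale ψ δ)) := by
  have := isProbabilityMeasure_meas μ
  have := hψ.isProbabilityMeasure
  have : IsProbabilityMeasure ((densityMeasure ψ).map fun x => δ • x) :=
    Measure.isProbabilityMeasure_map (by fun_prop)
  rw [measConv_eq, densityMeasure_rescale hψ.measurable hδ]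
  infer_instance

/-- The mollification `μ * ψ_δ` as an element of `P2 d`. -/
noncomputable def P2.mollify {d : ℕ} (hd : 2 ≤ d) (μ : P2 d) {ψ : EuclideanSpace ℝ (Fin d) → ℝ}
    (hψ : IsAdmissibleMollifier ψ) {δ : ℝ} (hδ : 0 < δ) : P2 d :=
  ⟨⟨measConv μ.meas (rescale ψ δ), isProbabilityMeasure_measConv_rescale hψ hδ μ⟩, by
    have := isProbabilityMeasure_meas μ
    have := hψ.isProbabilityMeasure
    have hμ : ∫⁻ x, ‖x‖ₑ ^ 2 ∂μ.meas < ⊤ := μ.2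
    have h2 := hψ.lintegral_enorm_sq_lt_top hd
    change ∫⁻ x, ‖x‖ₑ ^ 2 ∂measConv μ.meas (rescale ψ δ) < ⊤
    rw [lintegral_measConv_rescale _ hψ.measurable hδ (by fun_prop)]
    have hpt : ∀ x u : EuclideanSpace ℝ (Fin d),
        ‖x + δ • u‖ₑ ^ 2 ≤ 2 * ‖x‖ₑ ^ 2 + 2 * ‖δ‖ₑ ^ 2 * ‖u‖ₑ ^ 2 := by
      intro x u
      refine (pow_le_pow_left' (enorm_add_le _ _) 2).trans ((ennreal_add_sq_le _ _).trans_eq ?_)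
      rw [enorm_smul]
      ring
    refine (lintegral_mono fun x => lintegral_mono fun u => hpt x u).trans_lt ?_
    have hin : ∀ x : EuclideanSpace ℝ (Fin d),
        ∫⁻ u, (2 * ‖x‖ₑ ^ 2 + 2 * ‖δ‖ₑ ^ 2 * ‖u‖ₑ ^ 2) ∂densityMeasure ψ =
          2 * ‖x‖ₑ ^ 2 + 2 * ‖δ‖ₑ ^ 2 * ∫⁻ u, ‖u‖ₑ ^ 2 ∂densityMeasure ψ := by
      intro x
      rw [lintegral_add_left measurable_const, lintegral_const, measure_univ, mul_one,
        lintegral_const_mul _ (by fun_prop)]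
    simp_rw [hin]
    rw [lintegral_add_right _ measurable_const, lintegral_const, measure_univ,
      lintegral_const_mul _ (by fun_prop)]
    finiteness⟩

theorem P2.meas_mollify {d : ℕ} (hd : 2 ≤ d) (μ : P2 d) {ψ : EuclideanSpace ℝ (Fin d) → ℝ}
    (hψ : IsAdmissibleMollifier ψ) {δ : ℝ} (hδ : 0 < δ) :
    (μ.mollify hd hψ hδ).meas = measConv μ.meas (rescale ψ δ) := rfl

/-- Mollifying at scale `δ` moves a measure by at most `δ` times the root second moment of the
mollifier. -/
theorem dW_le_of_meas_eq_measConv {d : ℕ} {ψ : EuclideanSpace ℝ (Fin d) → ℝ}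
    (hψ : IsAdmissibleMollifier ψ) {δ : ℝ} (hδ : 0 < δ) {μ ν : P2 d}
    (hν : ν.meas = measConv μ.meas (rescale ψ δ)) :
    dW ν μ ≤ ENNReal.ofReal δ * (∫⁻ u, ‖u‖ₑ ^ 2 ∂densityMeasure ψ) ^ (1 / 2 : ℝ) := by
  have := isProbabilityMeasure_meas μ
  have := hψ.isProbabilityMeasure
  -- The plan is the law of `(X + δU, X)` with `X` and `U` independent; its cost is `δ²` times the
  -- second moment of `U`.
  have hg : Measurable fun z : EuclideanSpace ℝ (Fin d) × EuclideanSpace ℝ (Fin d) =>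
    (z.1 + δ • z.2, z.1) := by fun_prop
  have hprob : IsProbabilityMeasure ((μ.meas.prod (densityMeasure ψ)).map
      fun z => (z.1 + δ • z.2, z.1)) := Measure.isProbabilityMeasure_map hg.aemeasurable
  have hmem : (⟨_, hprob⟩ : ProbabilityMeasure
      (EuclideanSpace ℝ (Fin d) × EuclideanSpace ℝ (Fin d))) ∈
      transportPlans ν.meas μ.meas := by
    constructor
    · refine Measure.ext_of_lintegral _ fun f hf => ?_
      rw [hν, lintegral_measConv_rescale _ hψ.measurable hδ hf, ProbabilityMeasure.coe_mk,
        Measure.map_map measurable_fst hg, lintegral_map hf (measurable_fst.comp hg)]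
      exact lintegral_prod _ (hf.comp (measurable_fst.comp hg)).aemeasurable
    · rw [ProbabilityMeasure.coe_mk, Measure.map_map measurable_snd hg]
      exact measurePreserving_fst.map_eq
  have hcost : ∫⁻ z, ‖z.1 - z.2‖ₑ ^ 2 ∂((μ.meas.prod (densityMeasure ψ)).map
      fun z => (z.1 + δ • z.2, z.1)) =
      ENNReal.ofReal δ ^ 2 * ∫⁻ u, ‖u‖ₑ ^ 2 ∂densityMeasure ψ := by
    rw [lintegral_map (by fun_prop) hg]
    simp only [add_sub_cancel_left, enorm_smul, mul_pow]
    rw [lintegral_const_mul _ (by fun_prop),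
      measurePreserving_snd.lintegral_comp (f := fun x => ‖x‖ₑ ^ 2) (by fun_prop),
      Real.enorm_of_nonneg hδ.le]
  have h := ENNReal.rpow_le_rpow ((iInf₂_le (f := fun (γ : ProbabilityMeasure
      (EuclideanSpace ℝ (Fin d) × EuclideanSpace ℝ (Fin d))) (_ : γ ∈ transportPlans ν.meas μ.meas)
      => ∫⁻ z, ‖z.1 - z.2‖ₑ ^ 2 ∂γ.toMeasure) _ hmem).trans_eq hcost)
    (show (0 : ℝ) ≤ 1 / 2 by norm_num)
  refine h.trans_eq ?_
  rw [ENNReal.mul_rpow_of_nonneg _ _ (by norm_num), ← ENNReal.rpow_natCast, ← ENNReal.rpow_mul]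
  norm_num

theorem mainTheorem1 (d : ℕ) (p q : ℝ) (hdp : 2 - (d : ℝ) ≤ p) (hp : p < 0) (hq : 0 < q)
    (hq2 : q ≤ 2) (φ : EuclideanSpace ℝ (Fin d) → ℝ) (hφ : IsAdmissibleMollifier φ) :
    (∀ (μs : ℝ → P2 d) (μ : P2 d),
      Tendsto (fun ε => dW (μs ε) μ) (𝓝[>] 0) (𝓝 0) →
        interactionEnergy (powerKernel d p q) μ ≤
          liminf (fun ε => interactionEnergy (regKernel φ (powerKernel d p q) ε) (μs ε))
            (𝓝[>] 0)) ∧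
    (∀ μ : P2 d, ∃ νs : ℝ → P2 d,
      (∀ ε : ℝ, 0 < ε →
        (νs ε).meas = measConv μ.meas (rescale (heatKernel d) (ε ^ (1 / (2 * (d : ℝ)))))) ∧
      Tendsto (fun ε => dW (νs ε) μ) (𝓝[>] 0) (𝓝 0) ∧
      Tendsto (fun ε => interactionEnergy (regKernel φ (powerKernel d p q) ε) (νs ε))
        (𝓝[>] 0) (𝓝 (interactionEnergy (powerKernel d p q) μ))) := by
  have hK := continuous_powerKernel d hp hq
  have hlow := interactionEnergy_le_liminf hφ hK
  refine ⟨hlow, fun μ => ?_⟩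
  have hd : 2 < d := by
    have : (2 : ℝ) < d := by linarith
    exact_mod_cast this
  have hψ := isAdmissibleMollifier_heatKernel d
  set δ : ℝ → ℝ := fun ε => ε ^ (1 / (2 * (d : ℝ))) with hδdef
  have hδpos : ∀ {ε : ℝ}, 0 < ε → 0 < δ ε := fun hε => Real.rpow_pos_of_pos hε _
  have hδlim : Tendsto δ (𝓝[>] 0) (𝓝 0) := by
    have hd0 : (0 : ℝ) < 1 / (2 * (d : ℝ)) := by positivity
    have h := (Real.continuous_rpow_const hd0.le).tendsto 0
    rw [Real.zero_rpow hd0.ne'] at h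
    exact h.mono_left nhdsWithin_le_nhds
  -- The value for `ε ≤ 0` is arbitrary, as the limits see only `ε > 0`.
  let νs : ℝ → P2 d := fun ε => if hε : 0 < ε then μ.mollify hd.le hψ (hδpos hε) else μ
  have hνs : ∀ ε : ℝ, 0 < ε → (νs ε).meas = measConv μ.meas (rescale (heatKernel d) (δ ε)) := by
    intro ε hε
    simp only [νs, dif_pos hε, P2.meas_mollify]
  have hdW : Tendsto (fun ε => dW (νs ε) μ) (𝓝[>] 0) (𝓝 0) := by
    have hfin := hψ.lintegral_enorm_sq_lt_top hd.le
    have h0 : Tendsto (fun ε => ENNReal.ofReal (δ ε) *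
        (∫⁻ u, ‖u‖ₑ ^ 2 ∂densityMeasure (heatKernel d)) ^ (1 / 2 : ℝ)) (𝓝[>] 0) (𝓝 0) := by
      have h := ENNReal.Tendsto.mul_const (ENNReal.tendsto_ofReal hδlim)
        (Or.inr (ENNReal.rpow_ne_top_of_nonneg (by norm_num : (0 : ℝ) ≤ 1 / 2) hfin.ne))
      simpa using h
    refine tendsto_of_tendsto_of_tendsto_of_le_of_le' tendsto_const_nhds h0
      (Eventually.of_forall fun _ => zero_le) ?_
    filter_upwards [self_mem_nhdsWithin] with ε hε
    exact dW_le_of_meas_eq_measConv hψ (hδpos hε) (hνs ε hε)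
  refine ⟨νs, hνs, hdW, ?_⟩
  -- With infinite energy no majorant is available, but the liminf inequality along `νs` already
  -- forces the limit `⊤`.
  by_cases hμ : interactionEnergy (powerKernel d p q) μ = ⊤
  · rw [hμ]
    exact tendsto_of_le_liminf_of_limsup_le (hμ ▸ hlow νs μ hdW) le_top
  · have hpos : ∀ᶠ ε : ℝ in 𝓝[>] 0, 0 < ε := self_mem_nhdsWithin
    refine (tendsto_interactionEnergy_smear_powerKernel hd.le hψ hφ (by linarith) hp hq hq2 hδlim
      (tendsto_id.mono_left nhdsWithin_le_nhds) (hpos.mono fun ε hε => (hδpos hε).ne')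
      (hpos.mono fun ε hε => hε.ne') hμ).congr' ?_
    filter_upwards [hpos] with ε hε
    exact (interactionEnergy_regKernel_measConv hψ.measurable hφ.measurable hK.measurable
      (hδpos hε) hε (hνs ε hε)).symm
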